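/- Consider the Bell scenario with two parties, two measurements per party and two outcomes $\pm1$ per measurement. A quantum model consists of a complex Hilbert space $H$ of arbitrary dimension, two commuting von Neumann algebras $\mathcal A,\mathcal B$ on $H$ (the local operators of Alice and of Bob), self-adjoint operators $A_0,A_1\in\mathcal A$ and $B_0,B_1\in\mathcal B$ with $A_x^2=B_y^2=1$, and a unit vector $|\psi\rangle\in H$; its correlators are $\langle\psi|A_xB_y|\psi\rangle$, $x,y\in\{0,1\}$. Let $|\Phi^+\rangle=(|00\rangle+|11\rangle)/\sqrt2$. The numbers $E_{xy}$ are said to self-test the singlet if they are the correlators of some quantum model and there are unit vectors $\vec a_0,\vec a_1,\vec b_0,\vec b_1\in\mathbb R^3$ such that every quantum model with correlators $E_{xy}$ admits a local isometry $\Phi=\Phi_A\Phi_B$ on $H\otimes\mathbb C^2_{A'}\otimes\mathbb C^2_{B'}$ (where $\Phi_A$ is an isometry in $\mathcal A\otimes B(\mathbb C^2_{A'})$ and $\Phi_B$ is an isometry in $\mathcal B\otimes B(\mathbb C^2_{B'})$) and a vector $|\mathrm{junk}\rangle\in H$ with $$\Phi\,|\psi\rangle|00\rangle=|\mathrm{junk}\rangle|\Phi^+\rangle,\qquad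 \Phi\,A_xB_y|\psi\rangle|00\rangle=|\mathrm{junk}\rangle\,(\vec a_x\cdot\vec\sigma\otimes\vec b_y\cdot\vec\sigma)|\Phi^+\rangle\quad\text{for all }x,y\in\{0,1\},$$ where $\vec\sigma$ is the vector of Pauli matrices. **Theorem 1.** Let $E_{xy}\in[-1,1]$ for $x,y\in\{0,1\}$. The correlators $E_{xy}$ self-test the singlet if and only if both of the following hold: 1. they satisfy at least one of the eight equalities $$\sum_{(x,y)\neq(i,j)}\arcsin E_{xy}-\arcsin E_{ij}=\xi\pi,\qquad i,j\in\{0,1\},\ \xi\in\{+1,-1\},$$ with $\arcsin$ taking values in $[-\frac\pi2,\frac\pi2]$; 2. $E_{xy}\in\{1,-1\}$ for at most one pair $(x,y)$. -/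

import Mathlib

open scoped Matrix Kronecker

universe u

noncomputable section

/-- A quantum model of the Bell scenario with two parties, two measurements per party and two
outcomes per measurement, on a complex Hilbert space `H` of arbitrary dimension. The operators that
Alice and Bob can apply form two commuting von Neumann algebras on `H` (for `H = H_A ⊗ H_B` these
are `B(H_A) ⊗ 1` and `1 ⊗ B(H_B)`). The observables `A x` and `B y` are the differences of the two
projectors of a projective measurement, that is, self-adjoint operators of square one. -/
structure BellModel (H : Type*) [NormedAddCommGroup H] [InnerProductSpace ℂ H]
    [CompleteSpace H] where
  /-- the local operators of Alice -/
  algA : VonNeumannAlgebra H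
  /-- the local operators of Bob -/
  algB : VonNeumannAlgebra H
  comm : ∀ S ∈ algA, ∀ T ∈ algB, Commute S T
  /-- the two observables of Alice -/
  A : Fin 2 → H →L[ℂ] H
  /-- the two observables of Bob -/
  B : Fin 2 → H →L[ℂ] H
  A_mem : ∀ x, A x ∈ algA
  B_mem : ∀ y, B y ∈ algB
  A_selfAdjoint : ∀ x, IsSelfAdjoint (A x)
  B_selfAdjoint : ∀ y, IsSelfAdjoint (B y)
  A_sq : ∀ x, A x * A x = 1
  B_sq : ∀ y, B y * B y = 1
  /-- the shared pure state -/
  ψ : H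
  norm_ψ : ‖ψ‖ = 1

/-- The model has the correlators `E x y = ⟨ψ| A_x B_y |ψ⟩`. -/
def BellModel.Produces {H : Type*} [NormedAddCommGroup H] [InnerProductSpace ℂ H]
    [CompleteSpace H] (M : BellModel H) (E : Fin 2 → Fin 2 → ℝ) : Prop :=
  ∀ x y, inner ℂ M.ψ (M.A x (M.B y M.ψ)) = (E x y : ℂ)

/-- Vectors of the two auxiliary qubits `A'` and `B'`, in the computational basis `|i j⟩`. -/
abbrev TwoQubit : Type := Fin 2 × Fin 2 → ℂ

/-- The vector `|00⟩`. -/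
def ket00 : TwoQubit := Pi.single (0, 0) 1

/-- The maximally entangled state `(|00⟩ + |11⟩) / √2`. -/
def phiPlus : TwoQubit :=
  fun p => if p.1 = p.2 then ((1 / Real.sqrt 2 : ℝ) : ℂ) else 0

/-- The Pauli observable `v · σ = v₁ σ_x + v₂ σ_y + v₃ σ_z`. -/
def pauli (v : EuclideanSpace ℝ (Fin 3)) : Matrix (Fin 2) (Fin 2) ℂ :=
  (v 0 : ℂ) • !![0, 1; 1, 0] + (v 1 : ℂ) • !![0, -Complex.I; Complex.I, 0]
    + (v 2 : ℂ) • !![1, 0; 0, -1]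

section LocalIsometry

variable {H : Type*} [NormedAddCommGroup H] [InnerProductSpace ℂ H] [CompleteSpace H]

/-- The product vector `φ ⊗ χ` of `H ⊗ ℂ² ⊗ ℂ²`. A vector of `H ⊗ ℂ² ⊗ ℂ²` is written as the
family of its components in `H` along the basis vectors `|i j⟩` of the two qubits. -/
def withQubits (φ : H) (χ : TwoQubit) : Fin 2 × Fin 2 → H :=
  fun p => χ p • φ

/-- The action on `H ⊗ ℂ² ⊗ ℂ²` of an operator on `H ⊗ ℂ²`, where `ℂ²` is the first qubit; the
operator is given as a two by two matrix of operators on `H`. -/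
def actA (S : Matrix (Fin 2) (Fin 2) (H →L[ℂ] H)) (v : Fin 2 × Fin 2 → H) : Fin 2 × Fin 2 → H :=
  fun p => ∑ k, S p.1 k (v (k, p.2))

/-- The same for the second qubit. -/
def actB (T : Matrix (Fin 2) (Fin 2) (H →L[ℂ] H)) (v : Fin 2 × Fin 2 → H) : Fin 2 × Fin 2 → H :=
  fun p => ∑ l, T p.2 l (v (p.1, l))

/-- The operator matrix `S` is an isometry of `H ⊗ ℂ²` (that is, `S† S = 1`) which is local to the
party with algebra `𝒜`: it lies in `𝒜 ⊗ M₂(ℂ)`. -/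
def IsLocalIsometry (𝒜 : VonNeumannAlgebra H) (S : Matrix (Fin 2) (Fin 2) (H →L[ℂ] H)) : Prop :=
  (∀ i j, S i j ∈ 𝒜) ∧ Sᴴ * S = 1

/-- Some local isometry `Φ = Φ_A ⊗ Φ_B` maps `|ψ⟩|00⟩` to `|junk⟩|Φ⁺⟩` and `A_x B_y |ψ⟩|00⟩` to
`|junk⟩ (a_x·σ ⊗ b_y·σ)|Φ⁺⟩` for all `x` and `y`. -/
def BellModel.IsSinglet (M : BellModel H) (a b : Fin 2 → EuclideanSpace ℝ (Fin 3)) : Prop :=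
  ∃ (S T : Matrix (Fin 2) (Fin 2) (H →L[ℂ] H)) (junk : H),
    IsLocalIsometry M.algA S ∧ IsLocalIsometry M.algB T ∧
    actA S (actB T (withQubits M.ψ ket00)) = withQubits junk phiPlus ∧
    ∀ x y, actA S (actB T (withQubits (M.A x (M.B y M.ψ)) ket00)) =
      withQubits junk ((pauli (a x) ⊗ₖ pauli (b y)) *ᵥ phiPlus)

end LocalIsometry

/-- The correlators `E` self-test the singlet: quantum theory can produce them, and there are fixed
Pauli observables such that every model that produces `E` is, up to a local isometry, the singlet
measured with these observables. -/
def SelfTestsSinglet (E : Fin 2 → Fin 2 → ℝ) : Prop :=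
  (∃ (H : Type u) (_ : NormedAddCommGroup H) (_ : InnerProductSpace ℂ H) (_ : CompleteSpace H)
      (M : BellModel H), M.Produces E) ∧
  ∃ a b : Fin 2 → EuclideanSpace ℝ (Fin 3), (∀ x, ‖a x‖ = 1) ∧ (∀ y, ‖b y‖ = 1) ∧
    ∀ (H : Type u) [NormedAddCommGroup H] [InnerProductSpace ℂ H] [CompleteSpace H]
      (M : BellModel H), M.Produces E → M.IsSinglet a b

end

noncomputable section

/-! ### Involutions in a von Neumann algebra from an anticommutator relation on one vector -/

section Operators

variable {H : Type*} [NormedAddCommGroup H] [InnerProductSpace ℂ H] [CompleteSpace H]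

theorem VonNeumannAlgebra.smul_mem (𝒜 : VonNeumannAlgebra H) {T : H →L[ℂ] H} (hT : T ∈ 𝒜) (c : ℂ) :
    c • T ∈ 𝒜 :=
  𝒜.toStarSubalgebra.smul_mem hT c

/-- The projection onto the kernel of `D` commutes with every operator that commutes with `D` and
whose adjoint commutes with `D`. -/
theorem commute_starProjection_ker {D Y : H →L[ℂ] H} (h : Commute Y D)
    (h' : Commute (star Y) D) [D.ker.HasOrthogonalProjection] :
    Commute Y D.ker.starProjection := by
  set P := D.ker.starProjection with hP
  have key : ∀ W : H →L[ℂ] H, Commute W D → P * W * P = W * P := by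
    intro W hW
    ext v
    have hm : D (P v) = 0 := Submodule.starProjection_apply_mem D.ker v
    have : W (P v) ∈ D.ker := by
      change D (W (P v)) = 0
      have := congrArg (fun T : H →L[ℂ] H => T (P v)) hW.eq
      change W (D (P v)) = D (W (P v)) at this
      rw [← this, hm, map_zero]
    exact Submodule.starProjection_eq_self_iff.2 this
  have hsa : star P = P := (isSelfAdjoint_starProjection D.ker).star_eq
  -- Invariance of the kernel under `Y` and under `star Y` makes it a reducing subspace: the adjoint
  -- of the second identity gives `P Y P = P Y`.
  have h1 := key Y h
  have h2 := congrArg star (key (star Y) h')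
  simp only [star_mul, star_star, hsa] at h2
  rw [mul_assoc] at h1
  exact (h1.symm.trans h2)

/-- By the double commutant theorem it is enough to commute with the commutant, which is closed
under adjoints. -/
theorem starProjection_ker_mem (𝒜 : VonNeumannAlgebra H) {D : H →L[ℂ] H} (hD : D ∈ 𝒜)
    [D.ker.HasOrthogonalProjection] : D.ker.starProjection ∈ 𝒜 := by
  rw [← 𝒜.commutant_commutant, VonNeumannAlgebra.mem_commutant_iff]
  intro Y hY
  refine commute_starProjection_ker ?_ ?_
  · exact (VonNeumannAlgebra.mem_commutant_iff.1 hY D hD).symm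
  · exact (VonNeumannAlgebra.mem_commutant_iff.1 (star_mem hY) D hD).symm

/-- A self-adjoint operator that squares to one on the kernel of a commuting self-adjoint operator
`D` agrees there with a self-adjoint unitary. -/
theorem exists_involution_eqOn_ker (𝒜 : VonNeumannAlgebra H) {D W : H →L[ℂ] H} (hD : D ∈ 𝒜)
    (hW : W ∈ 𝒜) (hWsa : IsSelfAdjoint W) (hcomm : Commute W D)
    (hsq : ∀ v, D v = 0 → W (W v) = v) :
    ∃ V ∈ 𝒜, IsSelfAdjoint V ∧ V * V = 1 ∧ ∀ v, D v = 0 → V v = W v := by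
  have : CompleteSpace D.ker := D.isClosed_ker.completeSpace_coe
  set P := D.ker.starProjection with hP
  have hPm : P ∈ 𝒜 := starProjection_ker_mem 𝒜 hD
  have hPsa : star P = P := (isSelfAdjoint_starProjection D.ker).star_eq
  have hPP : P * P = P := Submodule.isIdempotentElem_starProjection (K := D.ker)
  have hWP : W * P = P * W :=
    commute_starProjection_ker hcomm (by rwa [hWsa.star_eq])
  have hWWP : W * W * P = P := by
    ext v
    exact hsq _ (Submodule.starProjection_apply_mem D.ker v)
  -- The extension is `W` on the kernel and the identity on its orthogonal complement.
  refine ⟨W * P + (1 - P), add_mem (mul_mem hW hPm) (sub_mem (one_mem 𝒜) hPm), ?_, ?_, ?_⟩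
  · rw [IsSelfAdjoint, star_add, star_mul, star_sub, star_one, hPsa, hWsa.star_eq, hWP]
  · have e1 : W * P * (W * P) = P := by
      rw [mul_assoc, ← mul_assoc P, ← hWP, mul_assoc W P P, hPP, ← mul_assoc, hWWP]
    have e2 : W * P * (1 - P) = 0 := by rw [mul_sub, mul_one, mul_assoc, hPP, sub_self]
    have e3 : (1 - P) * (W * P) = 0 := by
      rw [hWP, sub_mul, one_mul, ← mul_assoc, hPP, sub_self]
    have e4 : (1 - P) * (1 - P) = 1 - P := by
      rw [mul_sub, mul_one, sub_mul, one_mul, hPP, sub_self, sub_zero]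
    rw [mul_add, add_mul, add_mul, e1, e2, e3, e4]
    abel
  · intro v hv
    have : P v = v := Submodule.starProjection_eq_self_iff.2 hv
    simp [this]

omit [CompleteSpace H] in
theorem apply_apply_of_mul_self_eq_one {T : H →L[ℂ] H} (hT : T * T = 1) (v : H) : T (T v) = v := by
  simpa using congrArg (fun T : H →L[ℂ] H => T v) hT

/-- Two involutions whose anticommutator acts on `ψ` as `2 cos (φ 0 - φ 1)` act on `ψ` like
`cos (φ x) σ_z + sin (φ x) σ_x`, for two anticommuting involutions `σ_z` and `σ_x`. -/
theorem exists_anticommuting_involutions (𝒜 : VonNeumannAlgebra H) {A : Fin 2 → H →L[ℂ] H}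
    (hA : ∀ x, A x ∈ 𝒜) (hsa : ∀ x, IsSelfAdjoint (A x)) (hsq : ∀ x, A x * A x = 1)
    {φ : Fin 2 → ℝ} (hφ : Real.sin (φ 1 - φ 0) ≠ 0) {ψ : H}
    (hψ : A 0 (A 1 ψ) + A 1 (A 0 ψ) = (2 * (Real.cos (φ 0 - φ 1) : ℂ)) • ψ) :
    ∃ Z ∈ 𝒜, ∃ X ∈ 𝒜, IsSelfAdjoint Z ∧ IsSelfAdjoint X ∧ Z * Z = 1 ∧ X * X = 1 ∧
      Z (X ψ) = - X (Z ψ) ∧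
      ∀ x, A x ψ = (Real.cos (φ x) : ℂ) • Z ψ + (Real.sin (φ x) : ℂ) • X ψ := by
  set c : ℝ := Real.cos (φ 0 - φ 1) with hc
  set D : H →L[ℂ] H := A 0 * A 1 + A 1 * A 0 - (2 * (c : ℂ)) • 1 with hD
  have hDm : D ∈ 𝒜 := sub_mem (add_mem (mul_mem (hA 0) (hA 1)) (mul_mem (hA 1) (hA 0)))
    (𝒜.smul_mem (one_mem 𝒜) _)
  have hDa : ∀ v, D v = A 0 (A 1 v) + A 1 (A 0 v) - (2 * (c : ℂ)) • v := fun v => rfl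
  have hDv : ∀ v, D v = 0 → A 0 (A 1 v) = (2 * (c : ℂ)) • v - A 1 (A 0 v) := by
    intro v hv
    rw [hDa] at hv
    rw [← sub_eq_zero, ← hv]
    abel
  have hDψ : D ψ = 0 := by rw [hDa, hψ, sub_self]
  have s0 := apply_apply_of_mul_self_eq_one (hsq 0)
  have s1 := apply_apply_of_mul_self_eq_one (hsq 1)
  have hcomm : ∀ p q : ℂ, Commute (p • A 0 + q • A 1) D := by
    intro p q
    refine Commute.add_left (Commute.smul_left ?_ p) (Commute.smul_left ?_ q)
    · ext v
      simp [hD, s0]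
      abel
    · ext v
      simp [hD, s1]
      abel
  -- On the kernel of `D` the square of `p A_0 + q A_1` is the scalar `p² + q² + 2pqc`.
  have key : ∀ p q : ℝ, p ^ 2 + q ^ 2 + 2 * p * q * c = 1 →
      ∃ V ∈ 𝒜, IsSelfAdjoint V ∧ V * V = 1 ∧
        ∀ v, D v = 0 → V v = ((p : ℂ) • A 0 + (q : ℂ) • A 1) v := by
    intro p q hpq
    refine exists_involution_eqOn_ker 𝒜 hDm
      (add_mem (𝒜.smul_mem (hA 0) _) (𝒜.smul_mem (hA 1) _)) ?_ (hcomm p q) ?_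
    · rw [IsSelfAdjoint, star_add, star_smul, star_smul, (hsa 0).star_eq, (hsa 1).star_eq]
      simp
    · intro v hv
      have hpq' : (p : ℂ) ^ 2 + q ^ 2 + 2 * p * q * c = 1 := by exact_mod_cast hpq
      simp only [add_apply, smul_apply, map_add, map_smul,
        s0, s1, hDv v hv]
      have : v = ((p : ℂ) ^ 2 + q ^ 2 + 2 * p * q * c) • v := by rw [hpq', one_smul]
      conv_rhs => rw [this]
      module
  set s : ℝ := Real.sin (φ 1 - φ 0) with hs
  have hs' : s = Real.sin (φ 1) * Real.cos (φ 0) - Real.cos (φ 1) * Real.sin (φ 0) := by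
    rw [hs, Real.sin_sub]
  have hc' : c = Real.cos (φ 0) * Real.cos (φ 1) + Real.sin (φ 0) * Real.sin (φ 1) := by
    rw [hc, Real.cos_sub]
  have t0 := Real.sin_sq_add_cos_sq (φ 0)
  have t1 := Real.sin_sq_add_cos_sq (φ 1)
  -- The coefficients of `Z` and `X` invert the system `A_x = cos (φ x) Z + sin (φ x) X`, whose
  -- determinant is `s`.
  obtain ⟨Z, hZ, hZsa, hZsq, hZv⟩ := key (Real.sin (φ 1) / s) (-(Real.sin (φ 0) / s)) (by
    field_simp
    rw [hs', hc']
    linear_combination -Real.sin (φ 0) ^ 2 * t1 - Real.sin (φ 1) ^ 2 * t0)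
  obtain ⟨X, hX, hXsa, hXsq, hXv⟩ := key (-(Real.cos (φ 1) / s)) (Real.cos (φ 0) / s) (by
    field_simp
    rw [hs', hc']
    linear_combination -Real.cos (φ 0) ^ 2 * t1 - Real.cos (φ 1) ^ 2 * t0)
  have hker : ∀ p q : ℂ, D ((p • A 0 + q • A 1) ψ) = 0 := by
    intro p q
    have := congrArg (fun T : H →L[ℂ] H => T ψ) (hcomm p q).eq
    change (p • A 0 + q • A 1) (D ψ) = D ((p • A 0 + q • A 1) ψ) at this
    rw [← this, hDψ, map_zero]
  have hsC : (s : ℂ) ≠ 0 := by exact_mod_cast hφ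
  have hs'C : (s : ℂ) = (Real.sin (φ 1) : ℂ) * Real.cos (φ 0) - Real.cos (φ 1) * Real.sin (φ 0) := by
    exact_mod_cast hs'
  have hc'C : (c : ℂ) = (Real.cos (φ 0) : ℂ) * Real.cos (φ 1) + Real.sin (φ 0) * Real.sin (φ 1) := by
    exact_mod_cast hc'
  have t0C : (Real.sin (φ 0) : ℂ) ^ 2 + (Real.cos (φ 0) : ℂ) ^ 2 = 1 := by exact_mod_cast t0
  have t1C : (Real.sin (φ 1) : ℂ) ^ 2 + (Real.cos (φ 1) : ℂ) ^ 2 = 1 := by exact_mod_cast t1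
  refine ⟨Z, hZ, X, hX, hZsa, hXsa, hZsq, hXsq, ?_, ?_⟩
  · rw [hXv ψ hDψ, hZv ψ hDψ, hZv _ (hker _ _), hXv _ (hker _ _)]
    simp only [add_apply, smul_apply, map_add, map_smul, s0, s1, hDv ψ hDψ]
    simp only [Complex.ofReal_div, Complex.ofReal_neg]
    generalize (Real.sin (φ 0) : ℂ) = a at *
    generalize (Real.sin (φ 1) : ℂ) = b at *
    generalize (Real.cos (φ 0) : ℂ) = d at *
    generalize (Real.cos (φ 1) : ℂ) = e at *
    rw [← sub_eq_zero]
    match_scalars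
    · field_simp
      rw [hc'C]
      linear_combination 2 * b * e * t0C + 2 * a * d * t1C
    · field_simp
      ring
  · rw [Fin.forall_fin_two, hXv ψ hDψ, hZv ψ hDψ]
    simp only [add_apply, smul_apply]
    simp only [Complex.ofReal_div, Complex.ofReal_neg]
    generalize (Real.sin (φ 0) : ℂ) = a at *
    generalize (Real.sin (φ 1) : ℂ) = b at *
    generalize (Real.cos (φ 0) : ℂ) = d at *
    generalize (Real.cos (φ 1) : ℂ) = e at *
    constructor <;> match_scalars <;> field_simp <;>
      first | ring1 | linear_combination hs'C

end Operators

/-! ### The swap circuit and extraction of the singlet -/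

section SwapIsometry

variable {H : Type*} [NormedAddCommGroup H] [InnerProductSpace ℂ H] [CompleteSpace H]

/-- The swap circuit built from two involutions `Z` and `X`. -/
def swapIsometry (Z X : H →L[ℂ] H) : Matrix (Fin 2) (Fin 2) (H →L[ℂ] H) :=
  !![(1 / 2 : ℂ) • (1 + Z), (1 / 2 : ℂ) • (1 - Z);
    X * (1 / 2 : ℂ) • (1 - Z), X * (1 / 2 : ℂ) • (1 + Z)]

/-- The operators `(1 ± Z)/2` are complementary projections and `X` is unitary, so the two columns
are orthonormal. Only the first column meets `|00⟩`; the second completes the isometry. -/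
theorem isLocalIsometry_swapIsometry (𝒜 : VonNeumannAlgebra H) {Z X : H →L[ℂ] H} (hZ : Z ∈ 𝒜)
    (hX : X ∈ 𝒜) (hZsa : IsSelfAdjoint Z) (hXsa : IsSelfAdjoint X) (hZsq : Z * Z = 1)
    (hXsq : X * X = 1) : IsLocalIsometry 𝒜 (swapIsometry Z X) := by
  have hP : (1 / 2 : ℂ) • (1 + Z) ∈ 𝒜 := 𝒜.smul_mem (add_mem (one_mem 𝒜) hZ) _
  have hQ : (1 / 2 : ℂ) • (1 - Z) ∈ 𝒜 := 𝒜.smul_mem (sub_mem (one_mem 𝒜) hZ) _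
  have sP : star ((1 / 2 : ℂ) • (1 + Z)) = (1 / 2 : ℂ) • (1 + Z) := by
    simp [hZsa.star_eq]
  have sQ : star ((1 / 2 : ℂ) • (1 - Z)) = (1 / 2 : ℂ) • (1 - Z) := by
    simp [hZsa.star_eq]
  have PP : (1 / 2 : ℂ) • (1 + Z) * (1 / 2 : ℂ) • (1 + Z) = (1 / 2 : ℂ) • (1 + Z) := by
    simp only [smul_mul_smul_comm, mul_add, add_mul, hZsq, mul_one, one_mul]
    module
  have QQ : (1 / 2 : ℂ) • (1 - Z) * (1 / 2 : ℂ) • (1 - Z) = (1 / 2 : ℂ) • (1 - Z) := by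
    simp only [smul_mul_smul_comm, mul_sub, sub_mul, hZsq, mul_one, one_mul]
    module
  have PQ : (1 / 2 : ℂ) • (1 + Z) * (1 / 2 : ℂ) • (1 - Z) = 0 := by
    simp only [smul_mul_smul_comm, mul_sub, add_mul, hZsq, mul_one, one_mul]
    module
  have QP : (1 / 2 : ℂ) • (1 - Z) * (1 / 2 : ℂ) • (1 + Z) = 0 := by
    simp only [smul_mul_smul_comm, mul_add, sub_mul, hZsq, mul_one, one_mul]
    module
  have PaQ : (1 / 2 : ℂ) • (1 + Z) + (1 / 2 : ℂ) • (1 - Z) = 1 := by module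
  unfold swapIsometry
  generalize (1 / 2 : ℂ) • (1 + Z) = P at *
  generalize (1 / 2 : ℂ) • (1 - Z) = Q at *
  have XX : ∀ R T : H →L[ℂ] H, R * X * (X * T) = R * T := by
    intro R T
    rw [mul_assoc, ← mul_assoc X, hXsq, one_mul]
  constructor
  · intro i j
    fin_cases i <;> fin_cases j
    exacts [hP, hQ, mul_mem hX hQ, mul_mem hX hP]
  · ext1 i j
    fin_cases i <;> fin_cases j <;>
      simp [Matrix.mul_apply, sP, sQ, hXsa.star_eq, XX, PP, QQ, PQ, QP, PaQ, add_comm Q P]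

omit [CompleteSpace H] in
theorem actA_actB_withQubits_ket00 (S T : Matrix (Fin 2) (Fin 2) (H →L[ℂ] H)) (w : H)
    (p : Fin 2 × Fin 2) :
    actA S (actB T (withQubits w ket00)) p = S p.1 0 (T p.2 0 w) := by
  simp [actA, actB, withQubits, ket00, Pi.single_apply, Fin.sum_univ_two]

/-- The unit vector at angle `θ` in the plane of `σ_z` and `σ_x`. -/
def planeVector (θ : ℝ) : EuclideanSpace ℝ (Fin 3) := !₂[Real.sin θ, 0, Real.cos θ]

theorem norm_planeVector (θ : ℝ) : ‖planeVector θ‖ = 1 := by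
  simp [planeVector, EuclideanSpace.norm_eq, Fin.sum_univ_three]

theorem pauli_planeVector_kronecker_mulVec_phiPlus (α β : ℝ) :
    (pauli (planeVector α) ⊗ₖ pauli (planeVector β)) *ᵥ phiPlus =
      fun p => ((1 / Real.sqrt 2 : ℝ) : ℂ) *
        !![(Real.cos (α - β) : ℂ), -(Real.sin (α - β) : ℂ);
          (Real.sin (α - β) : ℂ), (Real.cos (α - β) : ℂ)] p.1 p.2 := by
  ext ⟨i, j⟩
  rw [Real.cos_sub, Real.sin_sub]
  fin_cases i <;> fin_cases j <;>
    simp [Matrix.mulVec, dotProduct, Fintype.sum_prod_type, Fin.sum_univ_two, phiPlus, pauli,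
      planeVector] <;> ring

/-- The swap circuits extract a singlet from a state on which the two parties have matching pairs of
anticommuting involutions. -/
theorem BellModel.isSinglet_of_anticommuting (M : BellModel H) {Z X Z' X' : H →L[ℂ] H}
    (hZ : Z ∈ M.algA) (hX : X ∈ M.algA) (hZ' : Z' ∈ M.algB) (hX' : X' ∈ M.algB)
    (hZsa : IsSelfAdjoint Z) (hXsa : IsSelfAdjoint X) (hZsa' : IsSelfAdjoint Z')
    (hXsa' : IsSelfAdjoint X') (hZsq : Z * Z = 1) (hXsq : X * X = 1) (hZsq' : Z' * Z' = 1)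
    (hXsq' : X' * X' = 1) (hZψ : Z' M.ψ = Z M.ψ) (hXψ : X' M.ψ = X M.ψ)
    (hanti : Z (X M.ψ) = - X (Z M.ψ)) (φ χ : Fin 2 → ℝ)
    (hA : ∀ x, M.A x M.ψ = (Real.cos (φ x) : ℂ) • Z M.ψ + (Real.sin (φ x) : ℂ) • X M.ψ)
    (hB : ∀ y, M.B y M.ψ = (Real.cos (χ y) : ℂ) • Z' M.ψ + (Real.sin (χ y) : ℂ) • X' M.ψ) :
    M.IsSinglet (fun x => planeVector (φ x)) (fun y => planeVector (χ y)) := by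
  have comm : ∀ S ∈ M.algA, ∀ T ∈ M.algB, ∀ v, T (S v) = S (T v) := by
    intro S hS T hT v
    exact (congrArg (fun R : H →L[ℂ] H => R v) (M.comm S hS T hT).eq).symm
  have zz := apply_apply_of_mul_self_eq_one hZsq
  have xx := apply_apply_of_mul_self_eq_one hXsq
  have zxz : Z (X (Z M.ψ)) = - X M.ψ := by
    rw [← neg_eq_iff_eq_neg.2 hanti, map_neg, zz]
  have cZZ := comm Z hZ Z' hZ'
  have cZX := comm Z hZ X' hX'
  have cXZ := comm X hX Z' hZ'
  have cXX := comm X hX X' hX'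
  -- Bob's involutions are moved onto `ψ` and replaced there by Alice's, so only `ψ` and `X Z ψ`
  -- survive.
  have hAB : ∀ x y, M.A x (M.B y M.ψ) = (Real.cos (φ x - χ y) : ℂ) • M.ψ
      + (Real.sin (φ x - χ y) : ℂ) • X (Z M.ψ) := by
    intro x y
    rw [hB, map_add, map_smul, map_smul, ← comm _ (M.A_mem x) _ hZ', ← comm _ (M.A_mem x) _ hX',
      hA, Real.cos_sub, Real.sin_sub]
    simp only [map_add, map_smul, cZZ, cZX, cXZ, cXX, hZψ, hXψ, zz, xx, hanti]
    push_cast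
    module
  have hsmul : ∀ (z : ℂ) (v : H),
      (((1 / Real.sqrt 2 : ℝ) : ℂ) * z) • ((Real.sqrt 2 : ℝ) : ℂ) • v = z • v := by
    intro z v
    rw [smul_smul, mul_right_comm, ← Complex.ofReal_mul]
    simp
  have hphi : phiPlus = fun p => ((1 / Real.sqrt 2 : ℝ) : ℂ) *
      (1 : Matrix (Fin 2) (Fin 2) ℂ) p.1 p.2 := by
    ext ⟨i, j⟩
    fin_cases i <;> fin_cases j <;> simp [phiPlus]
  -- The junk vector is read off from the `|00⟩` component `(1 + Z)/2 ψ`; the factor `√2` cancels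
  -- the amplitude of `Φ⁺`.
  refine ⟨swapIsometry Z X, swapIsometry Z' X',
    ((Real.sqrt 2 : ℝ) : ℂ) • ((1 / 2 : ℂ) • (M.ψ + Z M.ψ)),
    isLocalIsometry_swapIsometry _ hZ hX hZsa hXsa hZsq hXsq,
    isLocalIsometry_swapIsometry _ hZ' hX' hZsa' hXsa' hZsq' hXsq', ?_, ?_⟩
  · ext ⟨i, j⟩
    rw [actA_actB_withQubits_ket00, hphi]
    simp only [withQubits]
    rw [hsmul]
    fin_cases i <;> fin_cases j <;>
      simp [-one_div, swapIsometry, cZX, hZψ, hXψ, zz, xx, zxz, hanti] <;> module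
  · intro x y
    ext ⟨i, j⟩
    rw [actA_actB_withQubits_ket00, hAB, pauli_planeVector_kronecker_mulVec_phiPlus]
    simp only [withQubits]
    generalize (Real.cos (φ x - χ y) : ℂ) = c
    generalize (Real.sin (φ x - χ y) : ℂ) = s
    rw [hsmul]
    fin_cases i <;> fin_cases j <;>
      simp [-one_div, swapIsometry, cZZ, cZX, cXZ, cXX, hZψ, hXψ, zz, xx, zxz, hanti] <;> module

end SwapIsometry

/-! ### Spherical geometry of the correlation vectors -/

section PlanarRealizations

/-- The spherical triangle inequality, in the form of the Gram determinant of three unit vectors. -/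
theorem sq_inner_sub_mul_inner_le {V : Type*} [NormedAddCommGroup V] [InnerProductSpace ℝ V]
    {x y z : V} (hx : ‖x‖ = 1) (hy : ‖y‖ = 1) (hz : ‖z‖ = 1) :
    (inner ℝ y z - inner ℝ x y * inner ℝ x z) ^ 2 ≤
      (1 - inner ℝ x y ^ 2) * (1 - inner ℝ x z ^ 2) := by
  -- Cauchy–Schwarz for the components of `y` and `z` orthogonal to `x`.
  have h := real_inner_mul_inner_self_le (y - inner ℝ x y • x) (z - inner ℝ x z • x)
  have hxx : inner ℝ x x = (1 : ℝ) := by rw [real_inner_self_eq_norm_sq, hx]; norm_num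
  have hyy : inner ℝ y y = (1 : ℝ) := by rw [real_inner_self_eq_norm_sq, hy]; norm_num
  have hzz : inner ℝ z z = (1 : ℝ) := by rw [real_inner_self_eq_norm_sq, hz]; norm_num
  simp only [inner_sub_left, inner_sub_right, inner_smul_left, inner_smul_right, hxx, hyy, hzz,
    real_inner_comm x y, real_inner_comm x z, conj_trivial] at h
  nlinarith [h]

theorem cos_add_le_and_le_cos_sub {p q s : ℝ} (hp : 0 ≤ Real.sin p) (hq : 0 ≤ Real.sin q)
    (h : (s - Real.cos p * Real.cos q) ^ 2 ≤ (1 - Real.cos p ^ 2) * (1 - Real.cos q ^ 2)) :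
    Real.cos (p + q) ≤ s ∧ s ≤ Real.cos (p - q) := by
  rw [← Real.sin_sq, ← Real.sin_sq, ← mul_pow] at h
  have := abs_le.1 (abs_le_of_sq_le_sq h (mul_nonneg hp hq))
  rw [Real.cos_add, Real.cos_sub]
  constructor <;> linarith [this.1, this.2]

/-- Four unit vectors that saturate the chained spherical triangle inequality lie in a plane. -/
theorem planar_of_inner_eq_cos {V : Type*} [NormedAddCommGroup V] [InnerProductSpace ℝ V]
    {a b : Fin 2 → V} (ha : ∀ x, ‖a x‖ = 1) (hb : ∀ y, ‖b y‖ = 1) {φ χ : Fin 2 → ℝ}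
    (hab : ∀ x y, inner ℝ (a x) (b y) = Real.cos (φ x - χ y))
    (h01 : 0 ≤ Real.sin (φ 0 - χ 1)) (h00 : 0 ≤ Real.sin (χ 0 - φ 0))
    (h11 : 0 ≤ Real.sin (φ 1 - χ 1)) (h10 : 0 ≤ Real.sin (φ 1 - χ 0)) (x : Fin 2) :
    Real.sin (χ 0 - χ 1) • a x = Real.sin (φ x - χ 1) • b 0 + Real.sin (χ 0 - φ x) • b 1 := by
  have e00 : Real.cos (φ 0 - χ 0) = Real.cos (χ 0 - φ 0) := by rw [← Real.cos_neg]; ring_nf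
  -- The triangle through `a 1` bounds this inner product above and the triangle through `a 0`
  -- bounds it below; the two bounds coincide.
  have key : inner ℝ (b 0) (b 1) = Real.cos (χ 0 - χ 1) := by
    apply le_antisymm
    · have h := sq_inner_sub_mul_inner_le (ha 1) (hb 0) (hb 1)
      rw [hab, hab] at h
      have := (cos_add_le_and_le_cos_sub h10 h11 h).2
      rw [← Real.cos_neg] at this
      rwa [show -(φ 1 - χ 0 - (φ 1 - χ 1)) = χ 0 - χ 1 by ring] at this
    · have h := sq_inner_sub_mul_inner_le (ha 0) (hb 0) (hb 1)
      rw [hab, hab, e00] at h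
      have := (cos_add_le_and_le_cos_sub h00 h01 h).1
      rwa [show χ 0 - φ 0 + (φ 0 - χ 1) = χ 0 - χ 1 by ring] at this
  have haa : inner ℝ (a x) (a x) = (1 : ℝ) := by rw [real_inner_self_eq_norm_sq, ha]; norm_num
  have hbb : ∀ y, inner ℝ (b y) (b y) = (1 : ℝ) := fun y => by
    rw [real_inner_self_eq_norm_sq, hb]; norm_num
  -- All inner products are now known, so the squared norm of the difference can be computed to be
  -- zero.
  rw [← sub_eq_zero, ← inner_self_eq_zero (𝕜 := ℝ)]
  simp only [inner_sub_left, inner_sub_right, inner_add_left, inner_add_right, inner_smul_left,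
    inner_smul_right, haa, hbb, hab, key, real_inner_comm (a x), real_inner_comm (b 0) (b 1), conj_trivial]
  rw [← neg_sub (χ 0) (φ x), Real.cos_neg,
    show χ 0 - χ 1 = (φ x - χ 1) + (χ 0 - φ x) by ring, Real.cos_add, Real.sin_add]
  have t0 := Real.sin_sq_add_cos_sq (φ x - χ 1)
  have t1 := Real.sin_sq_add_cos_sq (χ 0 - φ x)
  linear_combination -Real.sin (φ x - χ 1) ^ 2 * t1 - Real.sin (χ 0 - φ x) ^ 2 * t0

end PlanarRealizations

/-! ### From saturation to the singlet -/

section SelfTest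

variable {H : Type*} [NormedAddCommGroup H] [InnerProductSpace ℂ H] [CompleteSpace H]

theorem IsSelfAdjoint.inner_apply_left {T : H →L[ℂ] H} (hT : IsSelfAdjoint T) (v w : H) :
    inner ℂ (T v) w = inner ℂ v (T w) := by
  rw [← ContinuousLinearMap.adjoint_inner_right, ← ContinuousLinearMap.star_eq_adjoint, hT.star_eq]

theorem norm_apply_of_involution {T : H →L[ℂ] H} (hT : IsSelfAdjoint T) (hsq : T * T = 1) (v : H) :
    ‖T v‖ = ‖v‖ := by
  have h : inner ℂ (T v) (T v) = inner ℂ v v := by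
    rw [hT.inner_apply_left, apply_apply_of_mul_self_eq_one hsq]
  rw [inner_self_eq_norm_sq_to_K, inner_self_eq_norm_sq_to_K] at h
  have h' : ‖T v‖ ^ 2 = ‖v‖ ^ 2 := by exact_mod_cast h
  exact (sq_eq_sq₀ (norm_nonneg _) (norm_nonneg _)).1 h'

theorem BellModel.apply_comm (M : BellModel H) {S T : H →L[ℂ] H} (hS : S ∈ M.algA)
    (hT : T ∈ M.algB) (v : H) : S (T v) = T (S v) :=
  congrArg (fun R : H →L[ℂ] H => R v) (M.comm S hS T hT).eq

theorem BellModel.inner_A_B (M : BellModel H) {E : Fin 2 → Fin 2 → ℝ} (hM : M.Produces E)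
    (x y : Fin 2) : inner ℂ (M.A x M.ψ) (M.B y M.ψ) = (E x y : ℂ) := by
  rw [(M.A_selfAdjoint x).inner_apply_left, hM]

theorem BellModel.planar (M : BellModel H) {E : Fin 2 → Fin 2 → ℝ} (hM : M.Produces E)
    {φ χ : Fin 2 → ℝ} (hE : ∀ x y, E x y = Real.cos (φ x - χ y))
    (h01 : 0 ≤ Real.sin (φ 0 - χ 1)) (h00 : 0 ≤ Real.sin (χ 0 - φ 0))
    (h11 : 0 ≤ Real.sin (φ 1 - χ 1)) (h10 : 0 ≤ Real.sin (φ 1 - χ 0)) (x : Fin 2) :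
    (Real.sin (χ 0 - χ 1) : ℂ) • M.A x M.ψ =
      (Real.sin (φ x - χ 1) : ℂ) • M.B 0 M.ψ + (Real.sin (χ 0 - φ x) : ℂ) • M.B 1 M.ψ := by
  let _ : InnerProductSpace ℝ H := InnerProductSpace.rclikeToReal ℂ H
  have := planar_of_inner_eq_cos (V := H) (a := fun x => M.A x M.ψ) (b := fun y => M.B y M.ψ)
    (fun x => by rw [norm_apply_of_involution (M.A_selfAdjoint x) (M.A_sq x), M.norm_ψ])
    (fun y => by rw [norm_apply_of_involution (M.B_selfAdjoint y) (M.B_sq y), M.norm_ψ])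
    (fun x y => by
      rw [real_inner_eq_re_inner ℂ, M.inner_A_B hM, ← hE]
      exact Complex.ofReal_re _) h01 h00 h11 h10 x
  simp only [RCLike.real_smul_eq_coe_smul (K := ℂ)] at this
  exact this

-- Applying `s A` to the relation and commuting it past Bob's operators gives `s² ψ = (p B₀ + q B₁)²
-- ψ`; the cross term is the anticommutator, isolated because `p q ≠ 0`.
omit [CompleteSpace H] in
theorem anticommutator_of_apply_eq {A B₀ B₁ : H →L[ℂ] H} (hA : A * A = 1) (hB₀ : B₀ * B₀ = 1)
    (hB₁ : B₁ * B₁ = 1) (hAB₀ : ∀ v, A (B₀ v) = B₀ (A v)) (hAB₁ : ∀ v, A (B₁ v) = B₁ (A v))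
    {ψ : H} {s p q c : ℂ} (h : s • A ψ = p • B₀ ψ + q • B₁ ψ) (hpq : p * q ≠ 0)
    (hs : s ^ 2 = p ^ 2 + q ^ 2 + 2 * p * q * c) :
    B₀ (B₁ ψ) + B₁ (B₀ ψ) = (2 * c) • ψ := by
  have hA' := apply_apply_of_mul_self_eq_one hA
  have h0 := apply_apply_of_mul_self_eq_one hB₀
  have h1 := apply_apply_of_mul_self_eq_one hB₁
  have e := congrArg (fun v => s • A v) h
  simp only [map_add, map_smul, hA', hAB₀, hAB₁] at e
  rw [smul_add, smul_comm s p, smul_comm s q, ← map_smul B₀, ← map_smul B₁, h] at e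
  simp only [map_add, map_smul, h0, h1] at e
  have : (p * q) • (B₀ (B₁ ψ) + B₁ (B₀ ψ)) = (p * q) • ((2 * c) • ψ) := by
    have e' : (s ^ 2) • ψ = (p ^ 2 + q ^ 2) • ψ + (p * q) • (B₀ (B₁ ψ) + B₁ (B₀ ψ)) := by
      rw [pow_two, mul_smul, e]
      module
    rw [hs] at e'
    rw [eq_comm, ← eq_sub_iff_add_eq'] at e'
    rw [e']
    module
  exact smul_right_injective H hpq this

-- Each product of Alice's operators on `ψ` becomes a product of Bob's in reverse order, since `A₀`
-- and `A₁` commute with them; symmetrizing leaves squares and Bob's anticommutator.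
omit [CompleteSpace H] in
theorem anticommutator_transfer {A₀ A₁ B₀ B₁ : H →L[ℂ] H} (hB₀ : B₀ * B₀ = 1)
    (hB₁ : B₁ * B₁ = 1) (h00 : ∀ v, A₀ (B₀ v) = B₀ (A₀ v)) (h01 : ∀ v, A₀ (B₁ v) = B₁ (A₀ v))
    (h10 : ∀ v, A₁ (B₀ v) = B₀ (A₁ v)) (h11 : ∀ v, A₁ (B₁ v) = B₁ (A₁ v))
    {ψ : H} {s p₀ q₀ p₁ q₁ c d : ℂ} (h₀ : s • A₀ ψ = p₀ • B₀ ψ + q₀ • B₁ ψ)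
    (h₁ : s • A₁ ψ = p₁ • B₀ ψ + q₁ • B₁ ψ) (hB : B₀ (B₁ ψ) + B₁ (B₀ ψ) = (2 * c) • ψ) (hs : s ≠ 0)
    (hd : s ^ 2 * d = p₀ * p₁ + q₀ * q₁ + (p₀ * q₁ + q₀ * p₁) * c) :
    A₀ (A₁ ψ) + A₁ (A₀ ψ) = (2 * d) • ψ := by
  have b0 := apply_apply_of_mul_self_eq_one hB₀
  have b1 := apply_apply_of_mul_self_eq_one hB₁
  have e01 : (s * s) • A₀ (A₁ ψ) = p₁ • B₀ (p₀ • B₀ ψ + q₀ • B₁ ψ) +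
      q₁ • B₁ (p₀ • B₀ ψ + q₀ • B₁ ψ) := by
    rw [mul_smul, ← map_smul A₀, h₁, ← h₀]
    simp only [map_add, map_smul, h00, h01]
    module
  have e10 : (s * s) • A₁ (A₀ ψ) = p₀ • B₀ (p₁ • B₀ ψ + q₁ • B₁ ψ) +
      q₀ • B₁ (p₁ • B₀ ψ + q₁ • B₁ ψ) := by
    rw [mul_smul, ← map_smul A₁, h₀, ← h₁]
    simp only [map_add, map_smul, h10, h11]
    module
  have hB' : B₀ (B₁ ψ) = (2 * c) • ψ - B₁ (B₀ ψ) := eq_sub_of_add_eq hB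
  apply smul_right_injective H (mul_ne_zero hs hs)
  change (s * s) • (A₀ (A₁ ψ) + A₁ (A₀ ψ)) = (s * s) • ((2 * d) • ψ)
  rw [smul_add, e01, e10, smul_smul, show s * s * (2 * d) = 2 * (s ^ 2 * d) by ring, hd]
  simp only [map_add, map_smul, b0, b1, hB']
  module

/-- A model whose correlators saturate the chained spherical triangle inequality, with
nondegenerate measurements, is a singlet. -/
theorem BellModel.isSinglet_of_saturated (M : BellModel H) {E : Fin 2 → Fin 2 → ℝ}
    (hM : M.Produces E) {φ χ : Fin 2 → ℝ} (hE : ∀ x y, E x y = Real.cos (φ x - χ y))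
    (h01 : 0 ≤ Real.sin (φ 0 - χ 1)) (h00 : 0 ≤ Real.sin (χ 0 - φ 0))
    (h11 : 0 ≤ Real.sin (φ 1 - χ 1)) (h10 : 0 ≤ Real.sin (φ 1 - χ 0))
    (hφ : Real.sin (φ 1 - φ 0) ≠ 0) (hχ : Real.sin (χ 0 - χ 1) ≠ 0)
    (hne : ∃ x, Real.sin (φ x - χ 1) * Real.sin (χ 0 - φ x) ≠ 0) :
    M.IsSinglet (fun x => planeVector (φ x)) (fun y => planeVector (χ y)) := by
  have hpl := M.planar hM hE h01 h00 h11 h10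
  have hχC : (Real.sin (χ 0 - χ 1) : ℂ) ≠ 0 := by exact_mod_cast hχ
  have comm : ∀ x y v, M.A x (M.B y v) = M.B y (M.A x v) := fun x y v =>
    M.apply_comm (M.A_mem x) (M.B_mem y) v
  have hB : M.B 0 (M.B 1 M.ψ) + M.B 1 (M.B 0 M.ψ) = (2 * (Real.cos (χ 0 - χ 1) : ℂ)) • M.ψ := by
    obtain ⟨x, hx⟩ := hne
    refine anticommutator_of_apply_eq (M.A_sq x) (M.B_sq 0) (M.B_sq 1) (comm x 0) (comm x 1)
      (hpl x) (by exact_mod_cast hx) ?_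
    norm_cast
    rw [show χ 0 - χ 1 = (φ x - χ 1) + (χ 0 - φ x) by ring, Real.cos_add, Real.sin_add]
    have t0 := Real.sin_sq_add_cos_sq (φ x - χ 1)
    have t1 := Real.sin_sq_add_cos_sq (χ 0 - φ x)
    linear_combination Real.sin (φ x - χ 1) ^ 2 * t1 + Real.sin (χ 0 - φ x) ^ 2 * t0
  have hA : M.A 0 (M.A 1 M.ψ) + M.A 1 (M.A 0 M.ψ) = (2 * (Real.cos (φ 0 - φ 1) : ℂ)) • M.ψ := by
    refine anticommutator_transfer (M.B_sq 0) (M.B_sq 1) (comm 0 0) (comm 0 1) (comm 1 0) (comm 1 1)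
      (hpl 0) (hpl 1) hB hχC ?_
    norm_cast
    rw [show φ 0 - φ 1 = (φ 0 - χ 1) - (φ 1 - χ 1) by ring,
      show χ 0 - φ 0 = (χ 0 - χ 1) - (φ 0 - χ 1) by ring,
      show χ 0 - φ 1 = (χ 0 - χ 1) - (φ 1 - χ 1) by ring]
    generalize φ 0 - χ 1 = u
    generalize φ 1 - χ 1 = v
    generalize χ 0 - χ 1 = w
    rw [Real.cos_sub, Real.sin_sub, Real.sin_sub]
    linear_combination (Real.sin u * Real.sin v) * Real.sin_sq_add_cos_sq w
  obtain ⟨Z, hZ, X, hX, hZsa, hXsa, hZsq, hXsq, hanti, hAv⟩ :=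
    exists_anticommuting_involutions M.algA M.A_mem M.A_selfAdjoint M.A_sq hφ hA
  obtain ⟨Z', hZ', X', hX', hZsa', hXsa', hZsq', hXsq', -, hBv⟩ :=
    exists_anticommuting_involutions M.algB M.B_mem M.B_selfAdjoint M.B_sq
      (by rw [← neg_sub, Real.sin_neg]; exact neg_ne_zero.2 hχ) hB
  have hAv' : ∀ x, M.A x M.ψ =
      (Real.cos (φ x) : ℂ) • Z' M.ψ + (Real.sin (φ x) : ℂ) • X' M.ψ := by
    intro x
    apply smul_right_injective H hχC
    change (Real.sin (χ 0 - χ 1) : ℂ) • M.A x M.ψ = (Real.sin (χ 0 - χ 1) : ℂ) •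
      ((Real.cos (φ x) : ℂ) • Z' M.ψ + (Real.sin (φ x) : ℂ) • X' M.ψ)
    rw [hpl, hBv, hBv]
    simp only [Real.sin_sub]
    push_cast
    match_scalars <;> ring
  have hφC : (Real.sin (φ 1 - φ 0) : ℂ) ≠ 0 := by exact_mod_cast hφ
  -- The vectors `A_x ψ` have the same coordinates in Alice's and Bob's involutions. This
  -- homogeneous system has determinant `sin (φ 1 - φ 0) ≠ 0`, so the involutions agree on `ψ`.
  have hd : ∀ x, (Real.cos (φ x) : ℂ) • (Z' M.ψ - Z M.ψ) +
      (Real.sin (φ x) : ℂ) • (X' M.ψ - X M.ψ) = 0 := by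
    intro x
    have := (hAv x).symm.trans (hAv' x)
    rw [← sub_eq_zero] at this
    rw [← neg_eq_zero, ← this]
    module
  have hd0 := hd 0
  have hd1 := hd 1
  rw [Real.sin_sub] at hφC
  push_cast at hφC hd0 hd1
  refine M.isSinglet_of_anticommuting hZ hX hZ' hX' hZsa hXsa hZsa' hXsa' hZsq hXsq hZsq' hXsq'
    ?_ ?_ hanti φ χ hAv hBv
  · rw [← sub_eq_zero]
    apply smul_right_injective H hφC
    simp only [smul_zero]
    linear_combination (norm := module) Complex.sin (φ 1) • hd0 - Complex.sin (φ 0) • hd1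
  · rw [← sub_eq_zero]
    apply smul_right_injective H hφC
    simp only [smul_zero]
    linear_combination (norm := module) Complex.cos (φ 0) • hd1 - Complex.cos (φ 1) • hd0

end SelfTest

/-! ### Quantities preserved by local isometries -/

section Invariants

variable {H : Type*} [NormedAddCommGroup H] [InnerProductSpace ℂ H] [CompleteSpace H]

theorem sum_inner_isometry {S : Matrix (Fin 2) (Fin 2) (H →L[ℂ] H)} (hS : Sᴴ * S = 1)
    (v w : Fin 2 → H) :
    ∑ i, inner ℂ (∑ k, S i k (v k)) (∑ l, S i l (w l)) = ∑ k, inner ℂ (v k) (w k) := by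
  have h : ∀ k l, ∑ i, inner ℂ (S i k (v k)) (S i l (w l)) =
      inner ℂ (v k) ((1 : Matrix (Fin 2) (Fin 2) (H →L[ℂ] H)) k l (w l)) := by
    intro k l
    rw [← hS, Matrix.mul_apply, sum_apply, inner_sum]
    refine Finset.sum_congr rfl fun i _ => ?_
    rw [Matrix.conjTranspose_apply, ContinuousLinearMap.star_eq_adjoint]
    exact (ContinuousLinearMap.adjoint_inner_right _ _ _).symm
  simp_rw [sum_inner, inner_sum]
  rw [Finset.sum_comm]
  refine Finset.sum_congr rfl fun k _ => ?_
  rw [Finset.sum_comm]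
  simp_rw [h]
  rw [Finset.sum_eq_single k]
  · simp
  · intro l _ hl
    simp [Matrix.one_apply_ne hl.symm]
  · simp

theorem sum_inner_actA {S : Matrix (Fin 2) (Fin 2) (H →L[ℂ] H)} (hS : Sᴴ * S = 1)
    (v w : Fin 2 × Fin 2 → H) :
    ∑ p, inner ℂ (actA S v p) (actA S w p) = ∑ p, inner ℂ (v p) (w p) := by
  rw [Fintype.sum_prod_type_right, Fintype.sum_prod_type_right]
  exact Finset.sum_congr rfl fun j _ => sum_inner_isometry hS (fun k => v (k, j)) fun k => w (k, j)

theorem sum_inner_actB {T : Matrix (Fin 2) (Fin 2) (H →L[ℂ] H)} (hT : Tᴴ * T = 1)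
    (v w : Fin 2 × Fin 2 → H) :
    ∑ p, inner ℂ (actB T v p) (actB T w p) = ∑ p, inner ℂ (v p) (w p) := by
  rw [Fintype.sum_prod_type, Fintype.sum_prod_type]
  exact Finset.sum_congr rfl fun i _ => sum_inner_isometry hT (fun k => v (i, k)) fun k => w (i, k)

omit [CompleteSpace H] in
theorem sum_inner_withQubits (φ φ' : H) (χ χ' : TwoQubit) :
    ∑ p, inner ℂ (withQubits φ χ p) (withQubits φ' χ' p) = (star χ ⬝ᵥ χ') * inner ℂ φ φ' := by
  simp only [withQubits, inner_smul_left, inner_smul_right, dotProduct, Finset.sum_mul]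
  refine Finset.sum_congr rfl fun p _ => ?_
  simp only [Pi.star_apply, RCLike.star_def]
  ring

theorem star_phiPlus_dotProduct_phiPlus : star phiPlus ⬝ᵥ phiPlus = 1 := by
  have h : ((Real.sqrt 2 : ℝ) : ℂ) * ((Real.sqrt 2 : ℝ) : ℂ) = 2 := by
    rw [← Complex.ofReal_mul, Real.mul_self_sqrt (by norm_num)]; norm_num
  simp [dotProduct, Fintype.sum_prod_type, phiPlus, ← mul_inv, h]

theorem star_ket00_dotProduct_ket00 : star ket00 ⬝ᵥ ket00 = 1 := by
  simp [dotProduct, ket00, Pi.single_apply]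

/-- The inner products of the vectors `A_x B_y |ψ⟩` of a singlet are those of the Pauli
observables. -/
theorem BellModel.IsSinglet.inner_eq {M : BellModel H} {a b : Fin 2 → EuclideanSpace ℝ (Fin 3)}
    (h : M.IsSinglet a b) (x y x' y' : Fin 2) :
    inner ℂ (M.A x (M.B y M.ψ)) (M.A x' (M.B y' M.ψ)) =
      star ((pauli (a x) ⊗ₖ pauli (b y)) *ᵥ phiPlus) ⬝ᵥ
        ((pauli (a x') ⊗ₖ pauli (b y')) *ᵥ phiPlus) := by
  obtain ⟨S, T, junk, ⟨-, hS⟩, ⟨-, hT⟩, h0, h1⟩ := h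
  have key : ∀ v w : H, ∑ p, inner ℂ (actA S (actB T (withQubits v ket00)) p)
      (actA S (actB T (withQubits w ket00)) p) = inner ℂ v w := by
    intro v w
    rw [sum_inner_actA hS, sum_inner_actB hT, sum_inner_withQubits, star_ket00_dotProduct_ket00,
      one_mul]
  have hjunk : inner ℂ junk junk = (1 : ℂ) := by
    have := key M.ψ M.ψ
    rw [h0, sum_inner_withQubits, star_phiPlus_dotProduct_phiPlus, one_mul,
      inner_self_eq_norm_sq_to_K M.ψ, M.norm_ψ] at this
    simpa using this
  rw [← key, h1, h1, sum_inner_withQubits, hjunk, mul_one]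

/-- A model in which all local operators commute is not a singlet. -/
theorem BellModel.not_isSinglet_of_commute (M : BellModel H)
    (hA : ∀ S ∈ M.algA, ∀ S' ∈ M.algA, Commute S S')
    (hB : ∀ T ∈ M.algB, ∀ T' ∈ M.algB, Commute T T')
    (a b : Fin 2 → EuclideanSpace ℝ (Fin 3)) : ¬ M.IsSinglet a b := by
  rintro ⟨S, T, junk, ⟨hSm, hS⟩, ⟨hTm, hT⟩, h0, -⟩
  have hp : ∀ p, S p.1 0 (T p.2 0 M.ψ) = phiPlus p • junk := by
    intro p
    rw [← actA_actB_withQubits_ket00, h0]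
    rfl
  have hc : ((1 / Real.sqrt 2 : ℝ) : ℂ) ≠ 0 := by
    norm_cast
    positivity
  have cS : ∀ i j v, S i 0 (S j 0 v) = S j 0 (S i 0 v) := fun i j v =>
    congrArg (fun R : H →L[ℂ] H => R v) (hA _ (hSm i 0) _ (hSm j 0)).eq
  have cT : ∀ i j v, T i 0 (T j 0 v) = T j 0 (T i 0 v) := fun i j v =>
    congrArg (fun R : H →L[ℂ] H => R v) (hB _ (hTm i 0) _ (hTm j 0)).eq
  have cST : ∀ i j v, S i 0 (T j 0 v) = T j 0 (S i 0 v) := fun i j v =>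
    M.apply_comm (hSm i 0) (hTm j 0) v
  have h00 : S 0 0 (T 0 0 M.ψ) = ((1 / Real.sqrt 2 : ℝ) : ℂ) • junk := by
    simpa [phiPlus] using hp (0, 0)
  have h11 : S 1 0 (T 1 0 M.ψ) = ((1 / Real.sqrt 2 : ℝ) : ℂ) • junk := by
    simpa [phiPlus] using hp (1, 1)
  have h01 : S 0 0 (T 1 0 M.ψ) = 0 := by simpa [phiPlus] using hp (0, 1)
  have h10 : S 1 0 (T 0 0 M.ψ) = 0 := by simpa [phiPlus] using hp (1, 0)
  -- The scaled junk vector equals both `S₀₀ T₀₀ ψ` and `S₁₀ T₁₀ ψ`. In each component one of these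
  -- two forms, after commuting factors, exposes a vanishing off-diagonal amplitude. The isometries
  -- thus kill the junk vector, and then `ψ` itself would vanish.
  have hjunk : ∀ p, actA S (actB T (withQubits (((1 / Real.sqrt 2 : ℝ) : ℂ) • junk) ket00)) p
      = 0 := by
    rintro ⟨i, j⟩
    rw [actA_actB_withQubits_ket00]
    fin_cases i <;> fin_cases j
    · change S 0 0 (T 0 0 _) = 0
      rw [← h11, ← cST 1 0, cT 0 1, cST 1 1, h10, map_zero, map_zero]
    · change S 0 0 (T 1 0 _) = 0
      rw [← h00, ← cST 0 1, cT 1 0, cST 0 0, h01, map_zero, map_zero]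
    · change S 1 0 (T 0 0 _) = 0
      rw [← h11, ← cST 1 0, cT 0 1, cST 1 1, h10, map_zero, map_zero]
    · change S 1 0 (T 1 0 _) = 0
      rw [← h00, ← cST 0 1, cT 1 0, cST 0 0, h01, map_zero, map_zero]
  have hn : inner ℂ (((1 / Real.sqrt 2 : ℝ) : ℂ) • junk) (((1 / Real.sqrt 2 : ℝ) : ℂ) • junk)
      = (0 : ℂ) := by
    rw [← one_mul (inner ℂ _ _), ← star_ket00_dotProduct_ket00, ← sum_inner_withQubits,
      ← sum_inner_actB hT, ← sum_inner_actA hS]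
    exact Finset.sum_eq_zero fun p _ => by rw [hjunk, inner_zero_left]
  have hj : junk = 0 := (smul_eq_zero.1 (inner_self_eq_zero.1 hn)).resolve_left hc
  have hψ : inner ℂ M.ψ M.ψ = (0 : ℂ) := by
    rw [← one_mul (inner ℂ _ _), ← star_ket00_dotProduct_ket00, ← sum_inner_withQubits,
      ← sum_inner_actB hT, ← sum_inner_actA hS, h0, hj]
    simp [withQubits]
  have := M.norm_ψ
  rw [inner_self_eq_zero.1 hψ, norm_zero] at this
  exact zero_ne_one this

end Invariants

/-! ### Relabelling symmetries -/

section Symmetry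

variable {H : Type*} [NormedAddCommGroup H] [InnerProductSpace ℂ H] [CompleteSpace H]

/-- Relabelling of the measurements and a common relabelling of the outcomes of Alice. -/
def BellModel.relabel (M : BellModel H) (σ τ : Fin 2 → Fin 2) (s : ℝ) (hs : s * s = 1) :
    BellModel H where
  algA := M.algA
  algB := M.algB
  comm := M.comm
  A x := (s : ℂ) • M.A (σ x)
  B y := M.B (τ y)
  A_mem x := M.algA.smul_mem (M.A_mem _) _
  B_mem y := M.B_mem _
  A_selfAdjoint x := by
    rw [IsSelfAdjoint, star_smul, (M.A_selfAdjoint _).star_eq]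
    simp
  B_selfAdjoint y := M.B_selfAdjoint _
  A_sq x := by
    rw [smul_mul_smul_comm, M.A_sq, ← Complex.ofReal_mul, hs]
    simp
  B_sq y := M.B_sq _
  ψ := M.ψ
  norm_ψ := M.norm_ψ

theorem BellModel.Produces.relabel {M : BellModel H} {E : Fin 2 → Fin 2 → ℝ} (h : M.Produces E)
    (σ τ : Fin 2 → Fin 2) {s : ℝ} (hs : s * s = 1) :
    (M.relabel σ τ s hs).Produces fun x y => s * E (σ x) (τ y) := by
  intro x y
  change inner ℂ M.ψ ((s : ℂ) • M.A (σ x) (M.B (τ y) M.ψ)) = _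
  rw [inner_smul_right, h, Complex.ofReal_mul]

theorem BellModel.relabel_relabel (M : BellModel H) (σ τ : Equiv.Perm (Fin 2)) {s : ℝ}
    (hs : s * s = 1) : (M.relabel σ.symm τ.symm s hs).relabel σ τ s hs = M := by
  cases M
  simp [BellModel.relabel, smul_smul, hs]

theorem pauli_smul (s : ℝ) (v : EuclideanSpace ℝ (Fin 3)) : pauli (s • v) = (s : ℂ) • pauli v := by
  simp only [pauli, PiLp.smul_apply, smul_eq_mul, Complex.ofReal_mul, mul_smul, smul_add]

theorem BellModel.IsSinglet.relabel {M : BellModel H} {a b : Fin 2 → EuclideanSpace ℝ (Fin 3)}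
    (h : M.IsSinglet a b) (σ τ : Fin 2 → Fin 2) {s : ℝ} (hs : s * s = 1) :
    (M.relabel σ τ s hs).IsSinglet (fun x => s • a (σ x)) (fun y => b (τ y)) := by
  obtain ⟨S, T, junk, hS, hT, h0, h1⟩ := h
  refine ⟨S, T, junk, hS, hT, h0, fun x y => ?_⟩
  have h1' := h1 (σ x) (τ y)
  ext p
  have h1p := congrFun h1' p
  change actA S (actB T (withQubits ((s : ℂ) • M.A (σ x) (M.B (τ y) M.ψ)) ket00)) p = _
  rw [actA_actB_withQubits_ket00] at h1p ⊢
  rw [map_smul, map_smul, h1p, pauli_smul, Matrix.smul_kronecker, Matrix.smul_mulVec]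
  simp only [withQubits, Pi.smul_apply, smul_smul, smul_eq_mul]

end Symmetry

theorem SelfTestsSinglet.relabel {E : Fin 2 → Fin 2 → ℝ} (h : SelfTestsSinglet.{u} E)
    (σ τ : Equiv.Perm (Fin 2)) {s : ℝ} (hs : s * s = 1) :
    SelfTestsSinglet.{u} fun x y => s * E (σ x) (τ y) := by
  obtain ⟨⟨H, i₁, i₂, i₃, M, hM⟩, a, b, ha, hb, hab⟩ := h
  refine ⟨⟨H, i₁, i₂, i₃, _, hM.relabel σ τ hs⟩, fun x => s • a (σ x), fun y => b (τ y), fun x => ?_,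
    fun y => hb _, ?_⟩
  · rw [norm_smul, ha, mul_one]
    rcases mul_self_eq_one_iff.1 hs with rfl | rfl <;> simp
  · intro K _ _ _ N hN
    rw [← N.relabel_relabel σ τ hs]
    refine BellModel.IsSinglet.relabel (hab K _ ?_) σ τ hs
    have := hN.relabel σ.symm τ.symm hs
    simpa [← mul_assoc, hs] using this

/-- All models that produce self-testing correlators agree on the inner products of the vectors
`A_x B_y |ψ⟩`. -/
theorem SelfTestsSinglet.inner_eq {E : Fin 2 → Fin 2 → ℝ} (h : SelfTestsSinglet.{u} E)
    {H K : Type u} [NormedAddCommGroup H] [InnerProductSpace ℂ H] [CompleteSpace H]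
    [NormedAddCommGroup K] [InnerProductSpace ℂ K] [CompleteSpace K]
    {M : BellModel H} {N : BellModel K} (hM : M.Produces E) (hN : N.Produces E)
    (x y x' y' : Fin 2) :
    inner ℂ (M.A x (M.B y M.ψ)) (M.A x' (M.B y' M.ψ)) =
      inner ℂ (N.A x (N.B y N.ψ)) (N.A x' (N.B y' N.ψ)) := by
  obtain ⟨-, a, b, -, -, hab⟩ := h
  rw [(hab H M hM).inner_eq, (hab K N hN).inner_eq]

/-! ### Von Neumann algebras generated by observables -/

section GeneratedAlgebra

variable {H : Type*} [NormedAddCommGroup H] [InnerProductSpace ℂ H] [CompleteSpace H]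

/-- The von Neumann algebra generated by a set of operators. -/
def VonNeumannAlgebra.generated (s : Set (H →L[ℂ] H)) : VonNeumannAlgebra H where
  toStarSubalgebra := StarSubalgebra.centralizer ℂ (StarSubalgebra.centralizer ℂ s : Set (H →L[ℂ] H))
  centralizer_centralizer' := by
    change Set.centralizer (Set.centralizer
      ((StarSubalgebra.centralizer ℂ (StarSubalgebra.centralizer ℂ s : Set (H →L[ℂ] H)) :
        StarSubalgebra ℂ (H →L[ℂ] H)) : Set (H →L[ℂ] H))) =
      ((StarSubalgebra.centralizer ℂ (StarSubalgebra.centralizer ℂ s : Set (H →L[ℂ] H)) :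
        StarSubalgebra ℂ (H →L[ℂ] H)) : Set (H →L[ℂ] H))
    rw [StarSubalgebra.coe_centralizer, Set.centralizer_centralizer_centralizer]

theorem VonNeumannAlgebra.mem_generated {s : Set (H →L[ℂ] H)} {T : H →L[ℂ] H} :
    T ∈ VonNeumannAlgebra.generated s ↔
      T ∈ StarSubalgebra.centralizer ℂ (StarSubalgebra.centralizer ℂ s : Set (H →L[ℂ] H)) :=
  Iff.rfl

theorem VonNeumannAlgebra.subset_generated {s : Set (H →L[ℂ] H)} {T : H →L[ℂ] H} (hT : T ∈ s) :
    T ∈ VonNeumannAlgebra.generated s := by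
  rw [mem_generated, StarSubalgebra.mem_centralizer_iff]
  intro g hg
  have h1 := (StarSubalgebra.mem_centralizer_iff ℂ).1 hg T hT
  have h2 := (StarSubalgebra.mem_centralizer_iff ℂ).1 (star_mem hg) T hT
  exact ⟨h1.1.symm, h2.1.symm⟩

/-- Two passages through commutants: `s` lies in the commutant of `t`, hence the algebra of `t` lies
in the commutant of `s`. Self-adjointness supplies the adjoint half of the centralizer condition. -/
theorem VonNeumannAlgebra.commute_generated {s t : Set (H →L[ℂ] H)}
    (hs : ∀ S ∈ s, IsSelfAdjoint S) (ht : ∀ T ∈ t, IsSelfAdjoint T)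
    (h : ∀ S ∈ s, ∀ T ∈ t, Commute S T) {S T : H →L[ℂ] H}
    (hS : S ∈ VonNeumannAlgebra.generated s) (hT : T ∈ VonNeumannAlgebra.generated t) :
    Commute S T := by
  have h1 : T ∈ StarSubalgebra.centralizer ℂ s := by
    rw [StarSubalgebra.mem_centralizer_iff]
    intro S' hS'
    have h2 : S' ∈ StarSubalgebra.centralizer ℂ t := by
      rw [StarSubalgebra.mem_centralizer_iff]
      intro T' hT'
      rw [(ht T' hT').star_eq]
      exact ⟨(h S' hS' T' hT').eq.symm, (h S' hS' T' hT').eq.symm⟩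
    rw [(hs S' hS').star_eq]
    have h3 := ((StarSubalgebra.mem_centralizer_iff ℂ).1 (mem_generated.1 hT) S' h2).1
    exact ⟨h3, h3⟩
  exact ((StarSubalgebra.mem_centralizer_iff ℂ).1 (mem_generated.1 hS) T h1).1.symm

/-- The Bell model in which the local algebras are generated by the observables. -/
def BellModel.ofCommuting (A B : Fin 2 → H →L[ℂ] H) (hA : ∀ x, IsSelfAdjoint (A x))
    (hB : ∀ y, IsSelfAdjoint (B y)) (hA₂ : ∀ x, A x * A x = 1) (hB₂ : ∀ y, B y * B y = 1)
    (hAB : ∀ x y, Commute (A x) (B y)) (ψ : H) (hψ : ‖ψ‖ = 1) : BellModel H where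
  algA := VonNeumannAlgebra.generated (Set.range A)
  algB := VonNeumannAlgebra.generated (Set.range B)
  comm := fun _ hS _ hT => VonNeumannAlgebra.commute_generated (Set.forall_mem_range.2 hA)
    (Set.forall_mem_range.2 hB)
    (Set.forall_mem_range.2 fun x => Set.forall_mem_range.2 fun y => hAB x y) hS hT
  A := A
  B := B
  A_mem x := VonNeumannAlgebra.subset_generated (Set.mem_range_self x)
  B_mem y := VonNeumannAlgebra.subset_generated (Set.mem_range_self y)
  A_selfAdjoint := hA
  B_selfAdjoint := hB
  A_sq := hA₂
  B_sq := hB₂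
  ψ := ψ
  norm_ψ := hψ

end GeneratedAlgebra

/-! ### Finite-dimensional models from matrices -/

section MatrixModel

variable {n : Type*} [Fintype n] [DecidableEq n]

/-- The operator of a matrix on a Hilbert space in an arbitrary universe. -/
def liftedOperator (A : Matrix n n ℂ) :
    EuclideanSpace ℂ (ULift.{u} n) →L[ℂ] EuclideanSpace ℂ (ULift.{u} n) :=
  Matrix.toEuclideanCLM (𝕜 := ℂ) (A.submatrix Equiv.ulift Equiv.ulift)

/-- The vector of a Hilbert space in an arbitrary universe with given coordinates. -/
def liftedVector (v : n → ℂ) : EuclideanSpace ℂ (ULift.{u} n) :=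
  WithLp.toLp 2 (v ∘ Equiv.ulift)

theorem liftedOperator_mul (A B : Matrix n n ℂ) :
    liftedOperator.{u} (A * B) = liftedOperator A * liftedOperator B := by
  rw [liftedOperator, liftedOperator, liftedOperator, ← map_mul, Matrix.submatrix_mul_equiv]

theorem liftedOperator_one : liftedOperator.{u} (1 : Matrix n n ℂ) = 1 := by
  rw [liftedOperator, Matrix.submatrix_one_equiv, map_one]

theorem isSelfAdjoint_liftedOperator {A : Matrix n n ℂ} (hA : A.IsHermitian) :
    IsSelfAdjoint (liftedOperator.{u} A) := by
  rw [IsSelfAdjoint, liftedOperator, ← map_star, Matrix.star_eq_conjTranspose,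
    Matrix.conjTranspose_submatrix, hA.eq]

theorem liftedOperator_liftedVector (A : Matrix n n ℂ) (v : n → ℂ) :
    liftedOperator.{u} A (liftedVector v) = liftedVector (A *ᵥ v) := by
  rw [liftedOperator, liftedVector, Matrix.toEuclideanCLM_toLp, liftedVector,
    Matrix.submatrix_mulVec_equiv]
  rfl

omit [DecidableEq n] in
theorem inner_liftedVector (v w : n → ℂ) :
    inner ℂ (liftedVector.{u} v) (liftedVector w) = star v ⬝ᵥ w := by
  rw [EuclideanSpace.inner_eq_star_dotProduct, dotProduct_comm]
  exact Equiv.sum_comp Equiv.ulift fun i => star v i * w i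

/-- Commuting matrices with a unit vector form a Bell model. -/
theorem exists_bellModel_of_matrices (A B : Fin 2 → Matrix n n ℂ) (hA : ∀ x, (A x).IsHermitian)
    (hB : ∀ y, (B y).IsHermitian) (hA₂ : ∀ x, A x * A x = 1) (hB₂ : ∀ y, B y * B y = 1)
    (hAB : ∀ x y, Commute (A x) (B y)) (v : n → ℂ) (hv : star v ⬝ᵥ v = 1) :
    ∃ M : BellModel (EuclideanSpace ℂ (ULift.{u} n)),
      (∀ x y, inner ℂ M.ψ (M.A x (M.B y M.ψ)) = star v ⬝ᵥ (A x *ᵥ (B y *ᵥ v))) ∧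
      (∀ x y x' y', inner ℂ (M.A x (M.B y M.ψ)) (M.A x' (M.B y' M.ψ)) =
        star (A x *ᵥ (B y *ᵥ v)) ⬝ᵥ (A x' *ᵥ (B y' *ᵥ v))) ∧
      ((∀ x x', Commute (A x) (A x')) → (∀ y y', Commute (B y) (B y')) →
        (∀ S ∈ M.algA, ∀ S' ∈ M.algA, Commute S S') ∧
        ∀ T ∈ M.algB, ∀ T' ∈ M.algB, Commute T T') := by
  have hc : ∀ C D : Matrix n n ℂ, Commute C D → Commute (liftedOperator.{u} C) (liftedOperator D) :=
    fun C D h => by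
      rw [commute_iff_eq, ← liftedOperator_mul, h.eq, liftedOperator_mul]
  have sA := fun x => isSelfAdjoint_liftedOperator.{u} (hA x)
  have sB := fun y => isSelfAdjoint_liftedOperator.{u} (hB y)
  refine ⟨BellModel.ofCommuting (fun x => liftedOperator (A x)) (fun y => liftedOperator (B y)) sA sB
    (fun x => by rw [← liftedOperator_mul, hA₂, liftedOperator_one])
    (fun y => by rw [← liftedOperator_mul, hB₂, liftedOperator_one])
    (fun x y => hc _ _ (hAB x y)) (liftedVector v) ?_, ?_, ?_, ?_⟩
  · have h := inner_liftedVector.{u} v v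
    rw [hv, inner_self_eq_norm_sq_to_K] at h
    have h' : ‖liftedVector.{u} v‖ ^ 2 = 1 :=
      Complex.ofReal_injective (by push_cast; exact h)
    exact (pow_eq_one_iff_of_nonneg (norm_nonneg _) two_ne_zero).1 h'
  · intro x y
    simp only [BellModel.ofCommuting, liftedOperator_liftedVector, inner_liftedVector]
  · intro x y x' y'
    simp only [BellModel.ofCommuting, liftedOperator_liftedVector, inner_liftedVector]
  · intro hAA hBB
    exact ⟨fun S hS S' hS' => VonNeumannAlgebra.commute_generated (Set.forall_mem_range.2 sA)
      (Set.forall_mem_range.2 sA)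
      (Set.forall_mem_range.2 fun x => Set.forall_mem_range.2 fun y => hc _ _ (hAA x y)) hS hS',
      fun S hS S' hS' => VonNeumannAlgebra.commute_generated (Set.forall_mem_range.2 sB)
      (Set.forall_mem_range.2 sB)
      (Set.forall_mem_range.2 fun x => Set.forall_mem_range.2 fun y => hc _ _ (hBB x y)) hS hS'⟩

end MatrixModel

/-! ### Models from Pauli observables with shared randomness -/

section PauliMixture

theorem inner_eq_sum_three (u v : EuclideanSpace ℝ (Fin 3)) :
    inner ℝ u v = u 0 * v 0 + u 1 * v 1 + u 2 * v 2 := by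
  simp [PiLp.inner_apply, Fin.sum_univ_three]
  ring

theorem isHermitian_pauli (u : EuclideanSpace ℝ (Fin 3)) : (pauli u).IsHermitian := by
  ext i j
  fin_cases i <;> fin_cases j <;> simp [pauli]

theorem pauli_mul_self {u : EuclideanSpace ℝ (Fin 3)} (hu : ‖u‖ = 1) : pauli u * pauli u = 1 := by
  have h : u 0 * u 0 + u 1 * u 1 + u 2 * u 2 = 1 := by
    rw [← inner_eq_sum_three, real_inner_self_eq_norm_sq, hu, one_pow]
  ext i j
  fin_cases i <;> fin_cases j <;> apply Complex.ext <;>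
    simp [pauli, Matrix.mul_apply, Fin.sum_univ_two] <;> linarith

theorem trace_pauli_mul (u v : EuclideanSpace ℝ (Fin 3)) :
    (pauli u * pauli v).trace = ((2 * inner ℝ u v : ℝ) : ℂ) := by
  rw [inner_eq_sum_three]
  apply Complex.ext <;>
    simp [pauli, Matrix.trace_fin_two] <;> ring

theorem sum_star_pauli_mul (u v u' v' : EuclideanSpace ℝ (Fin 3)) :
    ∑ i, ∑ j, star ((pauli u * pauli v) i j) * (pauli u' * pauli v') i j =
      ((2 * (inner ℝ u v * inner ℝ u' v' + inner ℝ u u' * inner ℝ v v' -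
        inner ℝ u v' * inner ℝ u' v) : ℝ) : ℂ) := by
  simp only [inner_eq_sum_three]
  apply Complex.ext <;>
    simp [pauli, Matrix.mul_apply, Fin.sum_univ_two] <;> ring

/-- The equal mixture of two pairs of Pauli observables of the singlet. -/
theorem exists_bellModel_of_unit_vectors (u v : Fin 2 → Fin 2 → EuclideanSpace ℝ (Fin 3))
    (hu : ∀ k x, ‖u k x‖ = 1) (hv : ∀ k y, ‖v k y‖ = 1) :
    ∃ (H : Type u) (_ : NormedAddCommGroup H) (_ : InnerProductSpace ℂ H) (_ : CompleteSpace H)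
      (M : BellModel H),
      (M.Produces fun x y => ∑ k, inner ℝ (u k x) (v k y) / 2) ∧
      ∀ x y x' y', inner ℂ (M.A x (M.B y M.ψ)) (M.A x' (M.B y' M.ψ)) =
        ((∑ k, (inner ℝ (u k x) (v k y) * inner ℝ (u k x') (v k y') +
          inner ℝ (u k x) (u k x') * inner ℝ (v k y) (v k y') -
          inner ℝ (u k x) (v k y') * inner ℝ (u k x') (v k y)) / 2 : ℝ) : ℂ) := by
  set A : Fin 2 → Matrix ((Fin 2 × Fin 2) × Fin 2) ((Fin 2 × Fin 2) × Fin 2) ℂ := fun x =>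
    Matrix.blockDiagonal fun k => pauli (u k x) ⊗ₖ (1 : Matrix (Fin 2) (Fin 2) ℂ) with hA
  set B : Fin 2 → Matrix ((Fin 2 × Fin 2) × Fin 2) ((Fin 2 × Fin 2) × Fin 2) ℂ := fun y =>
    Matrix.blockDiagonal fun k => (1 : Matrix (Fin 2) (Fin 2) ℂ) ⊗ₖ (pauli (v k y))ᵀ with hB
  -- The last index is the shared random bit; each block carries `Φ⁺` with weight one half. Read as
  -- a matrix, `Φ⁺` is a multiple of the identity, and the transpose on Bob's side makes `A_x B_y`
  -- produce a plain matrix product, so inner products become traces.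
  set w : (Fin 2 × Fin 2) × Fin 2 → ℂ := fun p => (1 / 2 : ℂ) * (1 : Matrix (Fin 2) (Fin 2) ℂ) p.1.1 p.1.2
    with hw
  have hABw : ∀ x y, A x *ᵥ (B y *ᵥ w) =
      fun p => (1 / 2 : ℂ) * (pauli (u p.2 x) * pauli (v p.2 y)) p.1.1 p.1.2 := by
    intro x y
    ext ⟨⟨i, j⟩, k⟩
    simp [hA, hB, hw, Matrix.mulVec, dotProduct, Fintype.sum_prod_type, Matrix.blockDiagonal_apply,
      Matrix.one_apply, Matrix.mul_apply]
    fin_cases i <;> fin_cases j <;> fin_cases k <;> simp <;> ring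
  obtain ⟨M, h1, h2, -⟩ := exists_bellModel_of_matrices.{u} A B
    (fun x => by
      rw [Matrix.IsHermitian, hA, Matrix.blockDiagonal_conjTranspose]
      simp [Matrix.conjTranspose_kronecker, (isHermitian_pauli _).eq])
    (fun y => by
      rw [Matrix.IsHermitian, hB, Matrix.blockDiagonal_conjTranspose]
      simp [Matrix.conjTranspose_kronecker, (isHermitian_pauli _).transpose.eq])
    (fun x => by
      rw [hA, ← Matrix.blockDiagonal_mul]
      simp only [← Matrix.mul_kronecker_mul, pauli_mul_self (hu _ _), mul_one,
        Matrix.one_kronecker_one]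
      exact Matrix.blockDiagonal_one)
    (fun y => by
      rw [hB, ← Matrix.blockDiagonal_mul]
      simp only [← Matrix.mul_kronecker_mul, ← Matrix.transpose_mul, pauli_mul_self (hv _ _),
        mul_one, Matrix.transpose_one, Matrix.one_kronecker_one]
      exact Matrix.blockDiagonal_one)
    (fun x y => by
      rw [commute_iff_eq, hA, hB, ← Matrix.blockDiagonal_mul, ← Matrix.blockDiagonal_mul]
      simp only [← Matrix.mul_kronecker_mul, mul_one, one_mul])
    w (by
      simp [hw, dotProduct, Fintype.sum_prod_type, Matrix.one_apply, map_ofNat]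
      norm_num)
  refine ⟨_, _, _, inferInstance, M, fun x y => ?_, fun x y x' y' => ?_⟩
  · rw [h1, hABw, dotProduct, Fintype.sum_prod_type_right]
    push_cast
    refine Finset.sum_congr rfl fun k _ => ?_
    have := trace_pauli_mul (u k x) (v k y)
    rw [Matrix.trace_fin_two] at this
    simp [hw, Fintype.sum_prod_type] at this ⊢
    linear_combination this / 4
  · rw [h2, hABw, hABw, dotProduct, Fintype.sum_prod_type_right]
    push_cast
    refine Finset.sum_congr rfl fun k _ => ?_
    have := sum_star_pauli_mul (u k x) (v k y) (u k x') (v k y')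
    simp [Fintype.sum_prod_type] at this ⊢
    linear_combination this / 4

end PauliMixture

/-! ### Mixtures of deterministic strategies -/

section ClassicalMixture

/-- Correlators of a classical mixture of two deterministic strategies do not self-test the
singlet. -/
theorem not_selfTestsSinglet_of_classical {E : Fin 2 → Fin 2 → ℝ} {f g : Fin 2 → Fin 2 → ℝ}
    {p : Fin 2 → ℝ} (hf : ∀ x k, f x k * f x k = 1) (hg : ∀ y k, g y k * g y k = 1)
    (hp : ∀ k, 0 ≤ p k) (hp1 : ∑ k, p k = 1) (hE : ∀ x y, E x y = ∑ k, p k * (f x k * g y k)) :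
    ¬ SelfTestsSinglet.{u} E := by
  rintro ⟨-, a, b, -, -, hab⟩
  have hsq : ∀ k, ((Real.sqrt (p k) : ℝ) : ℂ) * ((Real.sqrt (p k) : ℝ) : ℂ) = p k := fun k => by
    rw [← Complex.ofReal_mul, Real.mul_self_sqrt (hp k)]
  obtain ⟨M, h1, -, h3⟩ := exists_bellModel_of_matrices.{u}
    (fun x => Matrix.diagonal fun k => ((f x k : ℝ) : ℂ))
    (fun y => Matrix.diagonal fun k => ((g y k : ℝ) : ℂ))
    (fun x => by simp [Matrix.IsHermitian, Matrix.diagonal_conjTranspose, Pi.star_def])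
    (fun y => by simp [Matrix.IsHermitian, Matrix.diagonal_conjTranspose, Pi.star_def])
    (fun x => by simp [Matrix.diagonal_mul_diagonal, ← Complex.ofReal_mul, hf])
    (fun y => by simp [Matrix.diagonal_mul_diagonal, ← Complex.ofReal_mul, hg])
    (fun x y => by simp [commute_iff_eq, Matrix.diagonal_mul_diagonal, mul_comm])
    (fun k => ((Real.sqrt (p k) : ℝ) : ℂ))
    (by
      simp only [dotProduct, Pi.star_apply, RCLike.star_def, Complex.conj_ofReal, hsq]
      exact_mod_cast hp1)
  obtain ⟨hA, hB⟩ := h3 (fun x y => by simp [commute_iff_eq, Matrix.diagonal_mul_diagonal, mul_comm])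
    (fun x y => by simp [commute_iff_eq, Matrix.diagonal_mul_diagonal, mul_comm])
  refine M.not_isSinglet_of_commute hA hB a b (hab _ M fun x y => ?_)
  rw [h1, hE, dotProduct]
  push_cast
  refine Finset.sum_congr rfl fun k _ => ?_
  simp only [Matrix.mulVec_diagonal, Pi.star_apply, RCLike.star_def, Complex.conj_ofReal, ← hsq]
  ring

end ClassicalMixture

/-! ### Sufficiency in normal form -/

section Sufficiency

theorem inner_planeVector (α β : ℝ) :
    inner ℝ (planeVector α) (planeVector β) = Real.cos (α - β) := by
  rw [inner_eq_sum_three, Real.cos_sub]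
  simp [planeVector]
  ring

theorem eq_one_or_of_sin_arccos_eq_zero {x : ℝ} (h : Real.sin (Real.arccos x) = 0)
    (h1 : -1 ≤ x) (h2 : x ≤ 1) : x = 1 ∨ x = -1 := by
  rw [Real.sin_arccos, Real.sqrt_eq_zero (by nlinarith)] at h
  exact mul_self_eq_one_iff.1 (by linear_combination -h)

theorem selfTestsSinglet_of_arccos_eq {E : Fin 2 → Fin 2 → ℝ}
    (hE : ∀ x y, E x y ∈ Set.Icc (-1 : ℝ) 1)
    (hsat : Real.arccos (E 0 0) + Real.arccos (E 0 1) + Real.arccos (E 1 0) = Real.arccos (E 1 1))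
    (hone : ∀ p q : Fin 2 × Fin 2, (E p.1 p.2 = 1 ∨ E p.1 p.2 = -1) →
        (E q.1 q.2 = 1 ∨ E q.1 q.2 = -1) → p = q) : SelfTestsSinglet.{u} E := by
  have n00 := Real.arccos_nonneg (E 0 0)
  have n01 := Real.arccos_nonneg (E 0 1)
  have n10 := Real.arccos_nonneg (E 1 0)
  have n11 := Real.arccos_le_pi (E 1 1)
  have hcos : ∀ x y, Real.cos (Real.arccos (E x y)) = E x y := fun x y =>
    Real.cos_arccos (hE x y).1 (hE x y).2
  have hzero : ∀ x y, Real.arccos (E x y) = 0 → E x y = 1 ∨ E x y = -1 := by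
    intro x y h
    left
    rw [← hcos x y, h, Real.cos_zero]
  have hpi : ∀ x y, Real.arccos (E x y) = Real.pi → E x y = 1 ∨ E x y = -1 := by
    intro x y h
    right
    rw [← hcos x y, h, Real.cos_pi]
  have hsin : ∀ x y, Real.sin (Real.arccos (E x y)) = 0 → E x y = 1 ∨ E x y = -1 := fun x y h =>
    eq_one_or_of_sin_arccos_eq_zero h (hE x y).1 (hE x y).2
  -- The vectors lie on a half circle in the order `b 1`, `a 0`, `b 0`, `a 1`, with `b 1` at angle
  -- zero and consecutive gaps `θ_01`, `θ_00`, `θ_10`.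
  set φ : Fin 2 → ℝ := ![Real.arccos (E 0 1), Real.arccos (E 1 1)] with hφ
  set χ : Fin 2 → ℝ := ![Real.arccos (E 0 1) + Real.arccos (E 0 0), 0] with hχ
  have φ0 : φ 0 = Real.arccos (E 0 1) := rfl
  have φ1 : φ 1 = Real.arccos (E 1 1) := rfl
  have χ0 : χ 0 = Real.arccos (E 0 1) + Real.arccos (E 0 0) := rfl
  have χ1 : χ 1 = 0 := rfl
  have hcorr : ∀ x y, E x y = Real.cos (φ x - χ y) := by
    simp only [Fin.forall_fin_two, φ0, φ1, χ0, χ1, sub_zero, hcos, and_true]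
    constructor
    · rw [← Real.cos_neg]
      simp [hcos]
    · rw [← hsat]
      rw [show Real.arccos (E 0 0) + Real.arccos (E 0 1) + Real.arccos (E 1 0) -
        (Real.arccos (E 0 1) + Real.arccos (E 0 0)) = Real.arccos (E 1 0) by ring, hcos]
  constructor
  · obtain ⟨H, i₁, i₂, i₃, M, hM, -⟩ := exists_bellModel_of_unit_vectors.{u}
      (fun _ x => planeVector (φ x)) (fun _ y => planeVector (χ y))
      (fun _ _ => norm_planeVector _) (fun _ _ => norm_planeVector _)
    refine ⟨H, i₁, i₂, i₃, M, ?_⟩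
    convert hM using 3 with x y
    rw [Fin.sum_univ_two, inner_planeVector, ← hcorr]
    ring
  · refine ⟨fun x => planeVector (φ x), fun y => planeVector (χ y), fun x => norm_planeVector _,
      fun y => norm_planeVector _, ?_⟩
    intro H _ _ _ M hM
    refine M.isSinglet_of_saturated hM hcorr ?_ ?_ ?_ ?_ ?_ ?_ ?_
    · exact Real.sin_nonneg_of_nonneg_of_le_pi (by linarith) (by linarith)
    · exact Real.sin_nonneg_of_nonneg_of_le_pi (by linarith) (by linarith)
    · exact Real.sin_nonneg_of_nonneg_of_le_pi (by linarith) (by linarith)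
    · exact Real.sin_nonneg_of_nonneg_of_le_pi (by linarith) (by linarith)
    · refine (Real.sin_pos_of_pos_of_lt_pi ?_ ?_).ne'
      · by_contra! h
        have := hone (0, 0) (1, 0) (hzero 0 0 (by linarith)) (hzero 1 0 (by linarith))
        simp at this
      · by_contra! h
        have := hone (0, 1) (1, 1) (hzero 0 1 (by linarith)) (hpi 1 1 (by linarith))
        simp at this
    · refine (Real.sin_pos_of_pos_of_lt_pi ?_ ?_).ne'
      · by_contra! h
        have := hone (0, 0) (0, 1) (hzero 0 0 (by linarith)) (hzero 0 1 (by linarith))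
        simp at this
      · by_contra! h
        have := hone (1, 0) (1, 1) (hzero 1 0 (by linarith)) (hpi 1 1 (by linarith))
        simp at this
    · by_contra! h
      have e0 := h 0
      have e1 := h 1
      rw [φ0, χ0, χ1, sub_zero, add_sub_cancel_left, mul_eq_zero] at e0
      rw [φ1, χ0, χ1, sub_zero, ← neg_sub, Real.sin_neg, mul_neg, neg_eq_zero, ← hsat,
        show Real.arccos (E 0 0) + Real.arccos (E 0 1) + Real.arccos (E 1 0) -
        (Real.arccos (E 0 1) + Real.arccos (E 0 0)) = Real.arccos (E 1 0) by ring, hsat,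
        mul_eq_zero] at e1
      rcases e0 with e0 | e0 <;> rcases e1 with e1 | e1 <;>
        simpa using hone (_, _) (_, _) (hsin _ _ e0) (hsin _ _ e1)

end Sufficiency

/-! ### Gram completions and non-uniqueness of models -/

section Necessity

theorem BellModel.exists_gram {H : Type*} [NormedAddCommGroup H] [InnerProductSpace ℂ H]
    [CompleteSpace H] (M : BellModel H) {E : Fin 2 → Fin 2 → ℝ} (hM : M.Produces E) :
    ∃ t : ℝ, ∀ y, (t - E 0 y * E 1 y) ^ 2 ≤ (1 - E 0 y ^ 2) * (1 - E 1 y ^ 2) := by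
  let _ : InnerProductSpace ℝ H := InnerProductSpace.rclikeToReal ℂ H
  refine ⟨inner ℝ (M.A 0 M.ψ) (M.A 1 M.ψ), fun y => ?_⟩
  have nA : ∀ x, ‖M.A x M.ψ‖ = 1 := fun x => by
    rw [norm_apply_of_involution (M.A_selfAdjoint x) (M.A_sq x), M.norm_ψ]
  have nB : ‖M.B y M.ψ‖ = 1 := by
    rw [norm_apply_of_involution (M.B_selfAdjoint y) (M.B_sq y), M.norm_ψ]
  have e : ∀ x, inner ℝ (M.B y M.ψ) (M.A x M.ψ) = E x y := fun x => by
    rw [real_inner_comm, real_inner_eq_re_inner ℂ, M.inner_A_B hM]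
    exact Complex.ofReal_re _
  have := sq_inner_sub_mul_inner_le nB (nA 0) (nA 1)
  rwa [e, e] at this

theorem SelfTestsSinglet.exists_gram {E : Fin 2 → Fin 2 → ℝ} (h : SelfTestsSinglet.{u} E) :
    ∃ t : ℝ, ∀ y, (t - E 0 y * E 1 y) ^ 2 ≤ (1 - E 0 y ^ 2) * (1 - E 1 y ^ 2) := by
  obtain ⟨⟨H, _, _, _, M, hM⟩, -⟩ := h
  exact M.exists_gram hM

/-- Gram completion: correlators are realized by unit vectors of space in which the two vectors of
Alice have a prescribed inner product. -/
theorem exists_unit_vectors {E : Fin 2 → Fin 2 → ℝ} {t : ℝ} (ht : t ^ 2 < 1)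
    (h : ∀ y, (t - E 0 y * E 1 y) ^ 2 ≤ (1 - E 0 y ^ 2) * (1 - E 1 y ^ 2)) :
    ∃ u v : Fin 2 → EuclideanSpace ℝ (Fin 3), (∀ x, ‖u x‖ = 1) ∧ (∀ y, ‖v y‖ = 1) ∧
      (∀ x y, inner ℝ (u x) (v y) = E x y) ∧ inner ℝ (u 0) (u 1) = t := by
  have hpos : 0 < 1 - t ^ 2 := by linarith
  set r := Real.sqrt (1 - t ^ 2) with hr
  have hr2 : r ^ 2 = 1 - t ^ 2 := Real.sq_sqrt hpos.le
  have hr0 : r ≠ 0 := (Real.sqrt_pos.2 hpos).ne'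
  have hnorm : ∀ w : EuclideanSpace ℝ (Fin 3), inner ℝ w w = (1 : ℝ) → ‖w‖ = 1 := by
    intro w hw
    rw [real_inner_self_eq_norm_sq] at hw
    exact (pow_eq_one_iff_of_nonneg (norm_nonneg _) two_ne_zero).1 hw
  have hs : ∀ y, 0 ≤ 1 - E 0 y ^ 2 - ((E 1 y - t * E 0 y) / r) ^ 2 := by
    intro y
    rw [div_pow, hr2, sub_nonneg, div_le_iff₀ hpos]
    nlinarith [h y]
  -- The correlators force the first and third coordinates of Bob's vectors; the Gram inequality
  -- says precisely that the rest of the unit norm fits into the second.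
  refine ⟨![!₂[0, 0, 1], !₂[r, 0, t]], fun y => !₂[(E 1 y - t * E 0 y) / r,
    Real.sqrt (1 - E 0 y ^ 2 - ((E 1 y - t * E 0 y) / r) ^ 2), E 0 y], ?_, ?_, ?_, ?_⟩
  · rw [Fin.forall_fin_two]
    constructor <;> apply hnorm <;> rw [inner_eq_sum_three] <;> simp
    linarith
  · intro y
    apply hnorm
    rw [inner_eq_sum_three]
    simp [Real.mul_self_sqrt (hs y)]
    ring
  · intro x y
    rw [inner_eq_sum_three]
    fin_cases x
    · simp
    · simp [mul_div_cancel₀ _ hr0]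
  · rw [inner_eq_sum_three]
    simp

/-- In the Pauli model realizing `t`, the operator `B_0` cancels from `⟨A_0 B_0 ψ, A_1 B_0 ψ⟩`,
which therefore equals `t`; but self-testing fixes this number. -/
theorem SelfTestsSinglet.gram_unique {E : Fin 2 → Fin 2 → ℝ} (hE : SelfTestsSinglet.{u} E)
    {t t' : ℝ} (ht : t ^ 2 < 1) (ht' : t' ^ 2 < 1)
    (h : ∀ y, (t - E 0 y * E 1 y) ^ 2 ≤ (1 - E 0 y ^ 2) * (1 - E 1 y ^ 2))
    (h' : ∀ y, (t' - E 0 y * E 1 y) ^ 2 ≤ (1 - E 0 y ^ 2) * (1 - E 1 y ^ 2)) : t = t' := by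
  have key : ∀ {t : ℝ}, t ^ 2 < 1 →
      (∀ y, (t - E 0 y * E 1 y) ^ 2 ≤ (1 - E 0 y ^ 2) * (1 - E 1 y ^ 2)) →
      ∃ (H : Type u) (_ : NormedAddCommGroup H) (_ : InnerProductSpace ℂ H) (_ : CompleteSpace H)
        (M : BellModel H), M.Produces E ∧
        inner ℂ (M.A 0 (M.B 0 M.ψ)) (M.A 1 (M.B 0 M.ψ)) = (t : ℂ) := by
    intro t ht h
    obtain ⟨u, v, hu, hv, huv, huu⟩ := exists_unit_vectors ht h
    obtain ⟨H, i₁, i₂, i₃, M, hM, hM'⟩ := exists_bellModel_of_unit_vectors.{u}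
      (fun _ => u) (fun _ => v) (fun _ => hu) (fun _ => hv)
    refine ⟨H, i₁, i₂, i₃, M, ?_, ?_⟩
    · convert hM using 3 with x y
      rw [Fin.sum_univ_two, huv]
      ring
    · rw [hM', Fin.sum_univ_two, huv, huv, huu, real_inner_self_eq_norm_sq, hv]
      congr 1
      ring
  obtain ⟨H, i₁, i₂, i₃, M, hM, e⟩ := key ht h
  obtain ⟨K, j₁, j₂, j₃, N, hN, e'⟩ := key ht' h'
  have := hE.inner_eq hM hN 0 0 1 0
  rw [e, e'] at this
  exact_mod_cast this

/-- Correlators with a perfect correlation that lie in the interior of the remaining elliptope are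
not extremal, hence not self-testing. -/
theorem SelfTestsSinglet.not_interior {E : Fin 2 → Fin 2 → ℝ} (hE : SelfTestsSinglet.{u} E)
    (h00 : E 0 0 = 1) (h10 : E 1 0 ^ 2 < 1) :
    ¬ (E 1 0 - E 0 1 * E 1 1) ^ 2 < (1 - E 0 1 ^ 2) * (1 - E 1 1 ^ 2) := by
  intro hlt
  have ev1 : ∀ᶠ d in nhds (0 : ℝ), (E 1 0 + d) ^ 2 < 1 := by
    refine (Continuous.tendsto (by fun_prop) 0).eventually_lt_const (u := 1) ?_
    simpa using h10
  have ev2 : ∀ᶠ d in nhds (0 : ℝ), 0 < (1 - (E 0 1 + d) ^ 2) * (1 - E 1 1 ^ 2) -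
      (E 1 0 + d - (E 0 1 + d) * E 1 1) ^ 2 := by
    refine (Continuous.tendsto (by fun_prop) 0).eventually_const_lt (u := 0) ?_
    simpa using hlt
  obtain ⟨ε, hε, hball⟩ := Metric.eventually_nhds_iff.1 (ev1.and ev2)
  -- `E 0 1` and `E 1 0` are shifted together. The perfect correlation forces `u 0 = v 0`, so both
  -- shifts reappear in the inner products within each party.
  have key : ∀ d, |d| < ε → ∃ u v : Fin 2 → EuclideanSpace ℝ (Fin 3), (∀ x, ‖u x‖ = 1) ∧
      (∀ y, ‖v y‖ = 1) ∧ inner ℝ (u 0) (v 0) = (1 : ℝ) ∧ inner ℝ (u 0) (v 1) = E 0 1 + d ∧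
      inner ℝ (u 1) (v 0) = E 1 0 + d ∧ inner ℝ (u 1) (v 1) = E 1 1 ∧
      inner ℝ (u 0) (u 1) = E 1 0 + d ∧ inner ℝ (v 1) (v 0) = E 0 1 + d := by
    intro d hd
    obtain ⟨h1, h2⟩ := hball (show dist d 0 < ε by simpa using hd)
    obtain ⟨u, v, hu, hv, huv, huu⟩ := exists_unit_vectors
      (E := ![![1, E 0 1 + d], ![E 1 0 + d, E 1 1]]) h1 (by
        rw [Fin.forall_fin_two]
        constructor
        · simp
        · simp
          linarith)
    have e00 : inner ℝ (u 0) (v 0) = (1 : ℝ) := by simp [huv]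
    refine ⟨u, v, hu, hv, e00, by simp [huv], by simp [huv], by simp [huv], huu, ?_⟩
    rw [← (inner_eq_one_iff_of_norm_eq_one (𝕜 := ℝ) (hu 0) (hv 0)).1 e00, real_inner_comm]
    simp [huv]
  obtain ⟨u₀, v₀, hu₀, hv₀, a₀, b₀, c₀, d₀, e₀, f₀⟩ := key 0 (by simpa using hε)
  obtain ⟨u₁, v₁, hu₁, hv₁, a₁, b₁, c₁, d₁, e₁, f₁⟩ := key (ε / 2) (by
    rw [abs_of_pos (by linarith)]; linarith)
  obtain ⟨u₂, v₂, hu₂, hv₂, a₂, b₂, c₂, d₂, e₂, f₂⟩ := key (-(ε / 2)) (by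
    rw [abs_neg, abs_of_pos (by linarith)]; linarith)
  obtain ⟨H, _, _, _, M, hM, hM'⟩ := exists_bellModel_of_unit_vectors.{u}
    (fun _ => u₀) (fun _ => v₀) (fun _ => hu₀) (fun _ => hv₀)
  obtain ⟨K, _, _, _, N, hN, hN'⟩ := exists_bellModel_of_unit_vectors.{u}
    ![u₁, u₂] ![v₁, v₂] (by rw [Fin.forall_fin_two]; exact ⟨hu₁, hu₂⟩)
    (by rw [Fin.forall_fin_two]; exact ⟨hv₁, hv₂⟩)
  have pM : M.Produces E := by
    convert hM using 1
    ext x y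
    fin_cases x <;> fin_cases y <;> simp [a₀, b₀, c₀, d₀, h00] <;> ring
  have pN : N.Produces E := by
    convert hN using 1
    ext x y
    fin_cases x <;> fin_cases y <;> simp [Fin.sum_univ_two, a₁, b₁, c₁, d₁, a₂, b₂, c₂, d₂, h00] <;>
      ring
  -- This invariant is `2 (E 0 1 + d) (E 1 0 + d) - E 1 1`, quadratic in the shift `d`. Averaging
  -- over `±ε/2` keeps the correlators but raises it by `ε²/2`.
  have := hE.inner_eq pM pN 0 1 1 0
  rw [hM', hN', Complex.ofReal_inj] at this
  simp [Fin.sum_univ_two, a₀, b₀, c₀, d₀, e₀, f₀, a₁, b₁, c₁, d₁, e₁, f₁, a₂, b₂, c₂, d₂, e₂, f₂]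
    at this
  nlinarith [this, mul_pos hε hε]

/-- A second perfect correlator degenerates the Gram inequality into a product relation among the
correlators. One fair or biased sign then explains all of them: each case randomizes it with weights
`(1 ± e)/2`, for `e` equal to `E 1 0` or `E 0 1`. -/
theorem SelfTestsSinglet.not_two_perfect {E : Fin 2 → Fin 2 → ℝ} (hE : SelfTestsSinglet.{u} E)
    (hI : ∀ x y, E x y ∈ Set.Icc (-1 : ℝ) 1) (h00 : E 0 0 = 1) :
    E 0 1 ^ 2 ≠ 1 ∧ E 1 0 ^ 2 ≠ 1 ∧ E 1 1 ^ 2 ≠ 1 := by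
  obtain ⟨t, ht⟩ := hE.exists_gram
  have ht0 : t = E 1 0 := by
    have := ht 0
    rw [h00] at this
    nlinarith
  have ht1 := ht 1
  rw [ht0] at ht1
  have sum_one : ∀ e : ℝ, ∑ k, (![(1 + e) / 2, (1 - e) / 2] : Fin 2 → ℝ) k = 1 := fun e => by
    simp [Fin.sum_univ_two]; ring
  have nonneg : ∀ x y k, 0 ≤ (![(1 + E x y) / 2, (1 - E x y) / 2] : Fin 2 → ℝ) k := by
    intro x y
    rw [Fin.forall_fin_two]
    constructor
    · simp; linarith [(hI x y).1]
    · simp; linarith [(hI x y).2]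
  refine ⟨fun h => ?_, fun h => ?_, fun h => ?_⟩
  · have h10 : E 1 0 = E 0 1 * E 1 1 := by
      rw [h] at ht1
      nlinarith
    refine not_selfTestsSinglet_of_classical (f := ![fun _ => 1, ![1, -1]])
      (g := ![fun _ => 1, fun _ => E 0 1]) ?_ ?_ (nonneg 1 0) (sum_one _) ?_ hE
    · simp [Fin.forall_fin_two]
    · rw [pow_two, mul_self_eq_one_iff] at h
      rcases h with h' | h' <;> simp [Fin.forall_fin_two, h']
    · simp only [Fin.forall_fin_two, Fin.sum_univ_two]
      simp [h00]
      refine ⟨⟨?_, ?_⟩, ?_, ?_⟩ <;> first | ring1 | (rw [h10]; linear_combination (-E 1 1) * h)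
  · have h11 : E 1 1 = E 1 0 * E 0 1 := by
      have : (E 1 1 - E 1 0 * E 0 1) ^ 2 ≤ 0 := by nlinarith
      nlinarith
    refine not_selfTestsSinglet_of_classical (f := ![fun _ => 1, fun _ => E 1 0])
      (g := ![fun _ => 1, ![1, -1]]) ?_ ?_ (nonneg 0 1) (sum_one _) ?_ hE
    · rw [pow_two, mul_self_eq_one_iff] at h
      rcases h with h' | h' <;> simp [Fin.forall_fin_two, h']
    · simp [Fin.forall_fin_two]
    · simp only [Fin.forall_fin_two, Fin.sum_univ_two]
      simp [h00]
      refine ⟨⟨?_, ?_⟩, ?_, ?_⟩ <;> first | ring1 | (rw [h11]; ring1)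
  · have h10 : E 1 0 = E 0 1 * E 1 1 := by
      rw [h] at ht1
      nlinarith
    refine not_selfTestsSinglet_of_classical (f := ![fun _ => 1, ![E 1 1, -E 1 1]])
      (g := ![fun _ => 1, ![1, -1]]) ?_ ?_ (nonneg 0 1) (sum_one _) ?_ hE
    · rw [pow_two, mul_self_eq_one_iff] at h
      rcases h with h' | h' <;> simp [Fin.forall_fin_two, h']
    · simp [Fin.forall_fin_two]
    · simp only [Fin.forall_fin_two, Fin.sum_univ_two]
      simp [h00]
      refine ⟨⟨?_, ?_⟩, ?_, ?_⟩ <;> first | ring1 | (rw [h10]; ring1)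

end Necessity

/-! ### The arcsine equalities in terms of angles -/

section ArcsinCondition

/-- The eight equalities in terms of `arccos`. -/
theorem arcsin_condition_iff (E : Fin 2 → Fin 2 → ℝ) :
    (∃ i j : Fin 2, ∃ ξ : ℝ, (ξ = 1 ∨ ξ = -1) ∧
        (∑ p ∈ Finset.univ.erase (i, j), Real.arcsin (E p.1 p.2)) - Real.arcsin (E i j)
          = ξ * Real.pi) ↔
      ∃ i j : Fin 2, ∃ ξ : ℝ, (ξ = 1 ∨ ξ = -1) ∧
        Real.arccos (E 0 0) + Real.arccos (E 0 1) + Real.arccos (E 1 0) + Real.arccos (E 1 1)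
          - 2 * Real.arccos (E i j) = (1 - ξ) * Real.pi := by
  refine exists_congr fun i => exists_congr fun j => exists_congr fun ξ => and_congr_right fun _ => ?_
  rw [Finset.sum_erase_eq_sub (Finset.mem_univ _), Fintype.sum_prod_type]
  simp only [Fin.sum_univ_two, Real.arccos_eq_pi_div_two_sub_arcsin]
  constructor <;> intro h <;> linarith

/-- Cosine is injective on `[0, π]`, which contains `|p - q|` and one of `r + s`, `2π - (r + s)`;
the two signs and two branches give the four cases. -/
theorem eq_add_of_cos_sub_eq_cos_add {p q r s : ℝ} (hp : p ∈ Set.Icc 0 Real.pi)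
    (hq : q ∈ Set.Icc 0 Real.pi) (hr : r ∈ Set.Icc 0 Real.pi) (hs : s ∈ Set.Icc 0 Real.pi)
    (h : Real.cos (p - q) = Real.cos (r + s)) :
    p + q + r + s - 2 * p = 0 ∨ p + q + r + s - 2 * q = 0 ∨
      p + q + r + s - 2 * q = 2 * Real.pi ∨ p + q + r + s - 2 * p = 2 * Real.pi := by
  obtain ⟨hp0, hp1⟩ := hp
  obtain ⟨hq0, hq1⟩ := hq
  obtain ⟨hr0, hr1⟩ := hr
  obtain ⟨hs0, hs1⟩ := hs
  have habs : |p - q| ∈ Set.Icc 0 Real.pi := ⟨abs_nonneg _, abs_le.2 ⟨by linarith, by linarith⟩⟩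
  rw [← Real.cos_abs (p - q)] at h
  rcases le_total (r + s) Real.pi with hle | hle
  · have := Real.injOn_cos habs ⟨by linarith, hle⟩ h
    rcases abs_cases (p - q) with ⟨h1, -⟩ | ⟨h1, -⟩
    · left; linarith
    · right; left; linarith
  · rw [← Real.cos_two_pi_sub (r + s)] at h
    have := Real.injOn_cos habs ⟨by linarith, by linarith⟩ h
    rcases abs_cases (p - q) with ⟨h1, -⟩ | ⟨h1, -⟩
    · right; right; left; linarith
    · right; right; right; linarith

theorem arcsin_condition_of_cos_eq {E : Fin 2 → Fin 2 → ℝ}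
    (h : Real.cos (Real.arccos (E 0 0) - Real.arccos (E 1 0)) =
        Real.cos (Real.arccos (E 0 1) + Real.arccos (E 1 1)) ∨
      Real.cos (Real.arccos (E 0 1) - Real.arccos (E 1 1)) =
        Real.cos (Real.arccos (E 0 0) + Real.arccos (E 1 0))) :
    ∃ i j : Fin 2, ∃ ξ : ℝ, (ξ = 1 ∨ ξ = -1) ∧
        (∑ p ∈ Finset.univ.erase (i, j), Real.arcsin (E p.1 p.2)) - Real.arcsin (E i j)
          = ξ * Real.pi := by
  rw [arcsin_condition_iff]
  have m : ∀ x y, Real.arccos (E x y) ∈ Set.Icc 0 Real.pi := fun x y =>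
    ⟨Real.arccos_nonneg _, Real.arccos_le_pi _⟩
  rcases h with h | h
  · rcases eq_add_of_cos_sub_eq_cos_add (m _ _) (m _ _) (m _ _) (m _ _) h with h | h | h | h
    · exact ⟨0, 0, 1, Or.inl rfl, by linarith⟩
    · exact ⟨1, 0, 1, Or.inl rfl, by linarith⟩
    · exact ⟨1, 0, -1, Or.inr rfl, by linarith⟩
    · exact ⟨0, 0, -1, Or.inr rfl, by linarith⟩
  · rcases eq_add_of_cos_sub_eq_cos_add (m _ _) (m _ _) (m _ _) (m _ _) h with h | h | h | h
    · exact ⟨0, 1, 1, Or.inl rfl, by linarith⟩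
    · exact ⟨1, 1, 1, Or.inl rfl, by linarith⟩
    · exact ⟨1, 1, -1, Or.inr rfl, by linarith⟩
    · exact ⟨0, 1, -1, Or.inr rfl, by linarith⟩

theorem sum_arccos_relabel (E : Fin 2 → Fin 2 → ℝ) (σ τ : Equiv.Perm (Fin 2)) :
    Real.arccos (E (σ 0) (τ 0)) + Real.arccos (E (σ 0) (τ 1)) + Real.arccos (E (σ 1) (τ 0)) +
        Real.arccos (E (σ 1) (τ 1)) =
      Real.arccos (E 0 0) + Real.arccos (E 0 1) + Real.arccos (E 1 0) + Real.arccos (E 1 1) := by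
  have h := Fintype.sum_equiv (σ.prodCongr τ)
    (fun p => Real.arccos (E (σ p.1) (τ p.2))) (fun p => Real.arccos (E p.1 p.2)) fun p => rfl
  simp only [Fintype.sum_prod_type, Fin.sum_univ_two] at h
  linarith

theorem arcsin_condition_relabel {E : Fin 2 → Fin 2 → ℝ} (σ τ : Equiv.Perm (Fin 2)) {s : ℝ}
    (hs : s = 1 ∨ s = -1)
    (h : ∃ i j : Fin 2, ∃ ξ : ℝ, (ξ = 1 ∨ ξ = -1) ∧
        (∑ p ∈ Finset.univ.erase (i, j), Real.arcsin (s * E (σ p.1) (τ p.2)))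
          - Real.arcsin (s * E (σ i) (τ j)) = ξ * Real.pi) :
    ∃ i j : Fin 2, ∃ ξ : ℝ, (ξ = 1 ∨ ξ = -1) ∧
        (∑ p ∈ Finset.univ.erase (i, j), Real.arcsin (E p.1 p.2)) - Real.arcsin (E i j)
          = ξ * Real.pi := by
  rw [arcsin_condition_iff fun x y => s * E (σ x) (τ y)] at h
  rw [arcsin_condition_iff]
  obtain ⟨i, j, ξ, hξ, h⟩ := h
  have hsum := sum_arccos_relabel E σ τ
  rcases hs with rfl | rfl
  · simp only [one_mul] at h
    exact ⟨σ i, τ j, ξ, hξ, by linarith⟩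
  · simp only [neg_one_mul, Real.arccos_neg] at h
    -- Flipping outcomes replaces each angle by its supplement, which exchanges the two values of
    -- `ξ`.
    exact ⟨σ i, τ j, -ξ, by rcases hξ with rfl | rfl <;> simp, by linarith⟩

end ArcsinCondition

/-! ### Necessity of the arcsine equality, and the final equivalence -/

/-- Self-testing correlators without perfect correlations saturate one of the inequalities. -/
theorem SelfTestsSinglet.arcsin_condition_of_imperfect {E : Fin 2 → Fin 2 → ℝ}
    (hE : SelfTestsSinglet.{u} E) (hI : ∀ x y, E x y ∈ Set.Icc (-1 : ℝ) 1)
    (hne : ∀ x y, ¬ (E x y = 1 ∨ E x y = -1)) :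
    ∃ i j : Fin 2, ∃ ξ : ℝ, (ξ = 1 ∨ ξ = -1) ∧
        (∑ p ∈ Finset.univ.erase (i, j), Real.arcsin (E p.1 p.2)) - Real.arcsin (E i j)
          = ξ * Real.pi := by
  have hcos : ∀ x y, Real.cos (Real.arccos (E x y)) = E x y := fun x y =>
    Real.cos_arccos (hI x y).1 (hI x y).2
  have hsin : ∀ x y, 0 < Real.sin (Real.arccos (E x y)) := by
    intro x y
    refine lt_of_le_of_ne (Real.sin_nonneg_of_nonneg_of_le_pi (Real.arccos_nonneg _)
      (Real.arccos_le_pi _)) fun h => hne x y ?_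
    exact eq_one_or_of_sin_arccos_eq_zero h.symm (hI x y).1 (hI x y).2
  set l : Fin 2 → ℝ := fun y => Real.cos (Real.arccos (E 0 y) + Real.arccos (E 1 y)) with hl
  set m : Fin 2 → ℝ := fun y => Real.cos (Real.arccos (E 0 y) - Real.arccos (E 1 y)) with hm
  have hlm : ∀ y, l y < m y := by
    intro y
    simp only [hl, hm, Real.cos_add, Real.cos_sub]
    linarith [mul_pos (hsin 0 y) (hsin 1 y)]
  have hgram : ∀ {t y}, l y ≤ t → t ≤ m y →
      (t - E 0 y * E 1 y) ^ 2 ≤ (1 - E 0 y ^ 2) * (1 - E 1 y ^ 2) := by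
    intro t y h1 h2
    simp only [hl, hm, Real.cos_add, Real.cos_sub, hcos] at h1 h2
    have e : ∀ x, 1 - E x y ^ 2 = Real.sin (Real.arccos (E x y)) ^ 2 := fun x => by
      rw [Real.sin_sq, hcos]
    rw [e, e, ← mul_pow]
    exact sq_le_sq' (by linarith) (by linarith)
  obtain ⟨t, ht⟩ := hE.exists_gram
  have htlm : ∀ y, l y ≤ t ∧ t ≤ m y := by
    intro y
    refine cos_add_le_and_le_cos_sub (hsin 0 y).le (hsin 1 y).le ?_
    rw [hcos, hcos]
    exact ht y
  -- If the two admissible intervals for `t` overlap in more than a point, two distinct interior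
  -- values contradict uniqueness. Otherwise, being nondegenerate with a common point, they touch at
  -- opposite endpoints.
  by_cases hlt : max (l 0) (l 1) < min (m 0) (m 1)
  · exfalso
    obtain ⟨t₁, h1, h2⟩ := exists_between hlt
    obtain ⟨t₂, h3, h4⟩ := exists_between h2
    have hl' := max_lt_iff.1 h1
    have hm' := lt_min_iff.1 h4
    have b0 : -1 ≤ l 0 := Real.neg_one_le_cos _
    have b1 : m 0 ≤ 1 := Real.cos_le_one _
    have sq : ∀ {s : ℝ}, l 0 < s → s < m 0 → s ^ 2 < 1 := fun {s} h h' =>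
      (sq_lt_one_iff_abs_lt_one s).2 (abs_lt.2 ⟨by linarith, by linarith⟩)
    refine h3.ne (hE.gram_unique (sq hl'.1 (by linarith)) (sq (by linarith) hm'.1) ?_ ?_)
    · rw [Fin.forall_fin_two]
      exact ⟨hgram (by linarith) (by linarith), hgram (by linarith) (by linarith)⟩
    · rw [Fin.forall_fin_two]
      exact ⟨hgram (by linarith) (by linarith), hgram (by linarith) (by linarith)⟩
  · apply arcsin_condition_of_cos_eq
    have h0 := htlm 0
    have h1 := htlm 1
    have l0 := hlm 0
    have l1 := hlm 1
    change m 0 = l 1 ∨ m 1 = l 0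
    rw [max_lt_iff, lt_min_iff, lt_min_iff] at hlt
    by_contra! hcon
    refine hlt ⟨⟨l0, lt_of_le_of_ne (h0.1.trans h1.2) hcon.2.symm⟩,
      lt_of_le_of_ne (h1.1.trans h0.2) hcon.1.symm, l1⟩

/-- Self-testing correlators with one perfect correlation saturate one of the inequalities. -/
theorem SelfTestsSinglet.arcsin_condition_of_perfect {E : Fin 2 → Fin 2 → ℝ}
    (hE : SelfTestsSinglet.{u} E) (hI : ∀ x y, E x y ∈ Set.Icc (-1 : ℝ) 1) (h00 : E 0 0 = 1) :
    ∃ i j : Fin 2, ∃ ξ : ℝ, (ξ = 1 ∨ ξ = -1) ∧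
        (∑ p ∈ Finset.univ.erase (i, j), Real.arcsin (E p.1 p.2)) - Real.arcsin (E i j)
          = ξ * Real.pi := by
  have hcos : ∀ x y, Real.cos (Real.arccos (E x y)) = E x y := fun x y =>
    Real.cos_arccos (hI x y).1 (hI x y).2
  have sq : ∀ x y, E x y ^ 2 ≤ 1 := fun x y =>
    (sq_le_one_iff_abs_le_one _).2 (abs_le.2 (hI x y))
  obtain ⟨t, ht⟩ := hE.exists_gram
  have ht0 : t = E 1 0 := by
    have := ht 0
    rw [h00] at this
    nlinarith
  have ht1 := ht 1
  rw [ht0] at ht1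
  have heq : (E 1 0 - E 0 1 * E 1 1) ^ 2 = (1 - E 0 1 ^ 2) * (1 - E 1 1 ^ 2) := by
    refine le_antisymm ht1 (not_lt.1 (hE.not_interior h00 ?_))
    exact lt_of_le_of_ne (sq 1 0) (hE.not_two_perfect hI h00).2.1
  have e : ∀ x, 1 - E x 1 ^ 2 = Real.sin (Real.arccos (E x 1)) ^ 2 := fun x => by
    rw [Real.sin_sq, hcos]
  rw [e, e, ← mul_pow] at heq
  apply arcsin_condition_of_cos_eq
  rw [h00, Real.arccos_one, zero_sub, zero_add, Real.cos_neg, Real.cos_add, Real.cos_sub]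
  simp only [hcos]
  rcases sq_eq_sq_iff_eq_or_eq_neg.1 heq with h | h
  · right; linarith
  · left; linarith

theorem SelfTestsSinglet.relabel_perfect {E : Fin 2 → Fin 2 → ℝ} (hE : SelfTestsSinglet.{u} E)
    (hI : ∀ x y, E x y ∈ Set.Icc (-1 : ℝ) 1) {x y : Fin 2} (hxy : E x y = 1 ∨ E x y = -1) :
    ∃ E' : Fin 2 → Fin 2 → ℝ, E' = (fun x' y' => E x y * E (Equiv.swap 0 x x') (Equiv.swap 0 y y')) ∧
      SelfTestsSinglet.{u} E' ∧ (∀ x y, E' x y ∈ Set.Icc (-1 : ℝ) 1) ∧ E' 0 0 = 1 := by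
  have hs : E x y * E x y = 1 := mul_self_eq_one_iff.2 hxy
  refine ⟨_, rfl, hE.relabel _ _ hs, fun x' y' => ?_, by simpa using hs⟩
  obtain ⟨h1, h2⟩ := hI (Equiv.swap 0 x x') (Equiv.swap 0 y y')
  rcases hxy with h | h <;> rw [h] <;> constructor <;> linarith

end

theorem theorem1 (E : Fin 2 → Fin 2 → ℝ) (hE : ∀ x y, E x y ∈ Set.Icc (-1 : ℝ) 1) :
    SelfTestsSinglet.{u} E ↔
      (∃ i j : Fin 2, ∃ ξ : ℝ, (ξ = 1 ∨ ξ = -1) ∧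
        (∑ p ∈ Finset.univ.erase (i, j), Real.arcsin (E p.1 p.2)) - Real.arcsin (E i j)
          = ξ * Real.pi) ∧
      (∀ p q : Fin 2 × Fin 2, (E p.1 p.2 = 1 ∨ E p.1 p.2 = -1) →
        (E q.1 q.2 = 1 ∨ E q.1 q.2 = -1) → p = q) := by
  constructor
  · intro h
    refine ⟨?_, ?_⟩
    · by_cases hne : ∀ x y, ¬ (E x y = 1 ∨ E x y = -1)
      · exact h.arcsin_condition_of_imperfect hE hne
      · push Not at hne
        obtain ⟨x, y, hxy⟩ := hne
        obtain ⟨E', rfl, hT, hI, h00⟩ := h.relabel_perfect hE hxy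
        exact arcsin_condition_relabel _ _ hxy (hT.arcsin_condition_of_perfect hI h00)
    · rintro ⟨x, y⟩ ⟨x', y'⟩ hp hq
      obtain ⟨E', rfl, hT, hI, h00⟩ := h.relabel_perfect hE hp
      obtain ⟨h01, h10, h11⟩ := hT.not_two_perfect hI h00
      have hsq : (E x y * E x' y') ^ 2 = 1 := by
        simp only at hp hq
        rcases hp with hp | hp <;> rcases hq with hq | hq <;> rw [hp, hq] <;> norm_num
      fin_cases x <;> fin_cases y <;> fin_cases x' <;> fin_cases y' <;>
        first
        | rfl
        | (exfalso
           simp at h01 h10 h11 hsq hp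
           simp_all)
  · rintro ⟨hc, hone⟩
    rw [arcsin_condition_iff] at hc
    obtain ⟨i, j, ξ, hξ, hc⟩ := hc
    have hs : ξ * ξ = 1 := mul_self_eq_one_iff.2 hξ
    -- The normal form has its exceptional pair at `(1, 1)` and sign `+1`. The swaps and the factor
    -- `ξ` are involutions, so the same relabelling undoes this one.
    have hT : SelfTestsSinglet.{u} fun x y => ξ * E (Equiv.swap 1 i x) (Equiv.swap 1 j y) := by
      refine selfTestsSinglet_of_arccos_eq ?_ ?_ ?_
      · intro x y
        obtain ⟨h1, h2⟩ := hE (Equiv.swap 1 i x) (Equiv.swap 1 j y)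
        rcases hξ with h | h <;> rw [h] <;> constructor <;> linarith
      · have hsum := sum_arccos_relabel E (Equiv.swap 1 i) (Equiv.swap 1 j)
        rw [Equiv.swap_apply_left, Equiv.swap_apply_left] at *
        rcases hξ with rfl | rfl
        · simp only [one_mul]
          linarith
        · simp only [neg_one_mul, Real.arccos_neg]
          linarith
      · intro p q hp hq
        have hiff : ∀ e : ℝ, ξ * e = 1 ∨ ξ * e = -1 → e = 1 ∨ e = -1 := by
          intro e he
          rw [← mul_self_eq_one_iff] at he ⊢
          linear_combination he - e * e * hs
        have := hone (Equiv.swap 1 i p.1, Equiv.swap 1 j p.2) (Equiv.swap 1 i q.1, Equiv.swap 1 j q.2)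
          (hiff _ hp) (hiff _ hq)
        rw [Prod.mk.injEq] at this
        exact Prod.ext ((Equiv.swap 1 i).injective this.1) ((Equiv.swap 1 j).injective this.2)
    have := hT.relabel (Equiv.swap 1 i) (Equiv.swap 1 j) hs
    simpa [← mul_assoc, hs] using this
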